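/- Let $N\ge 1$, let $a_1,\dots,a_N$ be real constants, $p_N(\lambda)=\sum_{k=1}^N a_k\lambda^{2k+1}(-1)^k$, let $\kappa=\cos$ or $\kappa=\sin$, and put $I(t,x,\lambda)=\kappa\bigl(\lambda x+t\,p_N(\lambda)\bigr)$. Let $a\le b$, $c\le d$, $D=[a,b]\times[c,d]$ and $\varkappa=\max(b-a,d-c)$. For an even function $\varphi$ and a random variable $\zeta$ put $\tau_\varphi(\zeta)=\inf\{r>0:\ \mathsf E e^{\lambda\zeta}\le e^{\varphi(r\lambda)}\ \text{for all }\lambda\in\mathbb R\}$. A real random process $y=\{y(u),u\in\mathbb R\}$ is strictly $\varphi$-sub-Gaussian with determining constant $C_y$ if each $y(u)$ is centered with $\tau_\varphi(y(u))<\infty$ and $\tau_\varphi(\zeta)\le C_y(\mathsf E\zeta^2)^{1/2}$ for every linear combination $\zeta$ of the $y(u)$. Let $y$ be a real second-order process whose covariance function $\Gamma_y(s,t)=\mathsf E\,y(s)y(t)$ has finite Vitali variation on $\mathbb R^2$, and write $\iint f\,d|\Gamma_y|$ for the Stieltjes integral with respect to the variation of $\Gamma_y$ (the limit of the sums $\sum_{i,j}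 f\,|\Delta_i\Delta_j\Gamma_y|$). Let $\rho\in(0,1]$ be such that $$\iint_{\mathbb R^2}|\lambda|^{(2N+1)(\rho+1)}|\mu|^{(2N+1)(\rho+1)}\,d|\Gamma_y(\lambda,\mu)|<\infty ,$$ and define $C_Z\in[0,\infty]$ by $$C_Z^2=\iint_{\mathbb R^2}\Bigl(\bigl(\tfrac{|\lambda|}2\bigr)^\rho+\bigl|\tfrac12 p_N(\lambda)\bigr|^\rho\Bigr)\Bigl(\bigl(\tfrac{|\mu|}2\bigr)^\rho+\bigl|\tfrac12 p_N(\mu)\bigr|^\rho\Bigr)\,d|\Gamma_y(\lambda,\mu)| .$$ Let $U(t,x)=\int_{-\infty}^{\infty}I(t,x,\lambda)\,dy(\lambda)$, $(t,x)\in D$, the integral being taken in the mean-square sense. Suppose first that $y$ is strictly $\varphi$-sub-Gaussian with determining constant $C_y$, where $\varphi(x)=|x|^\alpha/\alpha$, $1<\alpha\le 2$. Then: (i) $U(t,x)$ exists for all $(t,x)\in D$ and has a version that is continuous on $D$ with probability one. For every $h>0$ $$\sup_{\substack{t,t_1\in[a,b]:\,|t-t_1|\le h\\ x,x_1\in[c,d]:\,|x-x_1|\le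 h}}\tau_\varphi\bigl(U(t,x)-U(t_1,x_1)\bigr)\le 2C_ZC_y\,h^\rho ,$$ and there is a finite constant $K$ such that the same supremum is at most $Kh^\rho$ for every $h>0$. (ii) Let $U$ be a version that is continuous with probability one, and put $\varepsilon_0=\sup_{(t,x)\in D}\tau_\varphi(U(t,x))$. Then $\varepsilon_0<\infty$, and for every $\theta\in(0,1)$ with $\theta\varepsilon_0<2C_ZC_y(\varkappa/2)^\rho$, for $\gamma$ with $\frac1\alpha+\frac1\gamma=1$, and for every $u>0$, $$\mathsf P\Bigl\{\sup_{(t,x)\in D}|U(t,x)|>u\Bigr\}\le 2\exp\Bigl\{-\frac{u^\gamma(1-\theta)^\gamma}{\gamma\,\varepsilon_0^\gamma}\Bigr\}(2eC_ZC_y)^{2/\rho}\varkappa^2(\theta\varepsilon_0)^{-2/\rho}$$ (if $\varepsilon_0=0$ the left-hand side is $0$). Now suppose instead that $y$ is a centered Gaussian process, and take $\varphi(x)=x^2/2$ in the definition of $\varepsilon_0$. Then $U$ exists and has a version that is continuous on $D$ with probability one; for every such version $\varepsilon_0<\infty$, and for every $\theta\in(0,1)$ with $\theta\varepsilon_0<2C_Z(\varkappa/2)^\rho$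 and every $u>0$, $$\mathsf P\Bigl\{\sup_{(t,x)\in D}|U(t,x)|>u\Bigr\}\le 2\exp\Bigl\{-\frac{u^2(1-\theta)^2}{2\varepsilon_0^2}\Bigr\}(2eC_Z)^{2/\rho}\varkappa^2(\theta\varepsilon_0)^{-2/\rho}.$$ -/

import Mathlib

open MeasureTheory ProbabilityTheory Filter Topology Set
open scoped ENNReal NNReal

noncomputable section

/-! ### `φ`-sub-Gaussian random variables and processes -/

/-- The Orlicz function `φ(x) = |x| ^ α / α`. -/
def powerOrlicz (α : ℝ) (x : ℝ) : ℝ := |x| ^ α / α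

/-- The `φ`-sub-Gaussian standard
`τ_φ(ζ) = inf {a > 0 : E exp(l ζ) ≤ exp(φ(a l)) for all l}`, with values in `[0, ∞]`
(it is `∞` if there is no such `a`). -/
def subGaussianStandard {Ω : Type*} [MeasurableSpace Ω] (φ : ℝ → ℝ) (ζ : Ω → ℝ)
    (P : Measure Ω) : ℝ≥0∞ :=
  ⨅ (a : ℝ) (_ : 0 < a ∧ ∀ l : ℝ,
      ∫⁻ ω, ENNReal.ofReal (Real.exp (l * ζ ω)) ∂P ≤ ENNReal.ofReal (Real.exp (φ (a * l)))),
    ENNReal.ofReal a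

/-- `ζ` belongs to the space `Sub_φ(Ω)` of `φ`-sub-Gaussian random variables. -/
structure IsPhiSubGaussian {Ω : Type*} [MeasurableSpace Ω] (φ : ℝ → ℝ) (ζ : Ω → ℝ)
    (P : Measure Ω) : Prop where
  aemeasurable : AEMeasurable ζ P
  centered : ∫ ω, ζ ω ∂P = 0
  exp_bound : ∃ a : ℝ, 0 < a ∧ ∀ l : ℝ,
    ∫⁻ ω, ENNReal.ofReal (Real.exp (l * ζ ω)) ∂P ≤ ENNReal.ofReal (Real.exp (φ (l * a)))

/-- `y` is a strictly `φ`-sub-Gaussian process with determining constant `C`: its values are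
`φ`-sub-Gaussian and `τ_φ(∑ cᵢ y(uᵢ)) ≤ C (E (∑ cᵢ y(uᵢ))²)^{1/2}` for all (finite) linear
combinations.  -/
structure IsStrictlyPhiSubGaussian {Ω : Type*} [MeasurableSpace Ω] (φ : ℝ → ℝ)
    (y : ℝ → Ω → ℝ) (C : ℝ≥0) (P : Measure Ω) : Prop where
  subGaussian : ∀ u, IsPhiSubGaussian φ (y u) P
  standard_le : ∀ (s : Finset ℝ) (c : ℝ → ℝ),
    subGaussianStandard φ (fun ω => ∑ u ∈ s, c u * y u ω) P
      ≤ (C : ℝ≥0∞) * eLpNorm (fun ω => ∑ u ∈ s, c u * y u ω) 2 P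

/-! ### Covariance functions of finite Vitali variation -/

/-- `Γ_y(s, t) = E y(s) y(t)`. -/
def covFun {Ω : Type*} [MeasurableSpace Ω] (y : ℝ → Ω → ℝ) (P : Measure Ω) (s t : ℝ) : ℝ :=
  ∫ ω, y s ω * y t ω ∂P

/-- The increment of `Γ` over the rectangle `[s, s'] × [t, t']`. -/
def rectIncrement (Γ : ℝ → ℝ → ℝ) (s s' t t' : ℝ) : ℝ :=
  Γ s' t' - Γ s' t - Γ s t' + Γ s t

/-- `Γ` has finite (Vitali) variation on the plane: the sums `∑ᵢ ∑ⱼ |Δᵢ Δⱼ Γ|` over all finite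
grids `s₀ ≤ ⋯ ≤ sₙ`, `t₀ ≤ ⋯ ≤ tₘ` are bounded. -/
def HasFiniteVitaliVariation (Γ : ℝ → ℝ → ℝ) : Prop :=
  ∃ V : ℝ, ∀ (n m : ℕ) (s t : ℕ → ℝ), Monotone s → Monotone t →
    ∑ i ∈ Finset.range n, ∑ j ∈ Finset.range m,
      |rectIncrement Γ (s i) (s (i + 1)) (t j) (t (j + 1))| ≤ V

/-- The integral `∫∫ f(l, m) d|Γ(l, m)|` over the plane of a continuous function `f ≥ 0` with
respect to the variation of `Γ`, with values in `[0, ∞]`: the limit of the sums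
`∑ᵢ ∑ⱼ f |Δᵢ Δⱼ Γ|` as the grid is refined and exhausts the plane. With the infimum of `f` over
each cell as the value of `f`, the sums increase under refinement and extension of the grid, and
the limit is their supremum. -/
def variationIntegral (Γ : ℝ → ℝ → ℝ) (f : ℝ → ℝ → ℝ≥0∞) : ℝ≥0∞ :=
  ⨆ (n : ℕ) (m : ℕ) (s : ℕ → ℝ) (t : ℕ → ℝ) (_ : Monotone s) (_ : Monotone t),
    ∑ i ∈ Finset.range n, ∑ j ∈ Finset.range m,
      (⨅ (u ∈ Icc (s i) (s (i + 1))) (v ∈ Icc (t j) (t (j + 1))), f u v) *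
        ENNReal.ofReal |rectIncrement Γ (s i) (s (i + 1)) (t j) (t (j + 1))|

/-! ### Mean-square Stieltjes integrals -/

/-- `J = ∫_A^B f(l) dy(l)` as the mean-square limit of the Riemann-Stieltjes sums
`∑ᵢ f(ξᵢ) (y(sᵢ₊₁) - y(sᵢ))`, `ξᵢ ∈ [sᵢ, sᵢ₊₁]`, as the mesh of the partition tends to `0`. -/
def IsMeanSquareIntegralOn {Ω : Type*} [MeasurableSpace Ω] (f : ℝ → ℝ) (y : ℝ → Ω → ℝ)
    (A B : ℝ) (J : Ω → ℝ) (P : Measure Ω) : Prop :=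
  MemLp J 2 P ∧
  ∀ ε : ℝ≥0∞, 0 < ε → ∃ δ : ℝ, 0 < δ ∧ ∀ (n : ℕ) (s ξ : ℕ → ℝ), Monotone s →
    s 0 = A → s n = B → (∀ i < n, s (i + 1) - s i < δ) →
    (∀ i < n, ξ i ∈ Icc (s i) (s (i + 1))) →
    eLpNorm (fun ω => (∑ i ∈ Finset.range n, f (ξ i) * (y (s (i + 1)) ω - y (s i) ω)) - J ω) 2 P
      ≤ ε

/-- `J = ∫_{-∞}^{∞} f(l) dy(l)` in the mean-square sense: the mean-square limit of
`∫_A^B f(l) dy(l)` as `A → -∞`, `B → ∞`. -/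
def IsMeanSquareIntegral {Ω : Type*} [MeasurableSpace Ω] (f : ℝ → ℝ) (y : ℝ → Ω → ℝ)
    (J : Ω → ℝ) (P : Measure Ω) : Prop :=
  MemLp J 2 P ∧
  ∃ K : ℝ → ℝ → Ω → ℝ, (∀ A B : ℝ, A ≤ B → IsMeanSquareIntegralOn f y A B (K A B) P) ∧
    Tendsto (fun p : ℝ × ℝ => eLpNorm (fun ω => K p.1 p.2 ω - J ω) 2 P)
      (atBot ×ˢ atTop) (𝓝 0)

/-! ### The random field `U` -/

/-- The polynomial `∑_{k=1}^N a_k l^{2k+1} (-1)^k`. -/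
def dispersionPoly (N : ℕ) (coef : ℕ → ℝ) (l : ℝ) : ℝ :=
  ∑ k ∈ Finset.Icc 1 N, coef k * l ^ (2 * k + 1) * (-1) ^ k

/-- The kernel `I(t, x, l) = κ(l x + t ∑_{k=1}^N a_k l^{2k+1} (-1)^k)`. -/
def solutionKernel (κ : ℝ → ℝ) (N : ℕ) (coef : ℕ → ℝ) (t x l : ℝ) : ℝ :=
  κ (l * x + t * dispersionPoly N coef l)

/-- The random field `U` on `D` (first coordinate `t`, second coordinate `x`) is given by
`U(t, x) = ∫ I(t, x, l) dy(l)`. -/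
def IsSolutionField {Ω : Type*} [MeasurableSpace Ω] (κ : ℝ → ℝ) (N : ℕ) (coef : ℕ → ℝ)
    (y : ℝ → Ω → ℝ) (D : Set (ℝ × ℝ)) (U : ℝ × ℝ → Ω → ℝ) (P : Measure Ω) : Prop :=
  ∀ p ∈ D, IsMeanSquareIntegral (solutionKernel κ N coef p.1 p.2) y (U p) P

/-- `U` has continuous sample paths on `D` with probability one. -/
def HasContinuousPathsOn {Ω : Type*} [MeasurableSpace Ω] (D : Set (ℝ × ℝ))
    (U : ℝ × ℝ → Ω → ℝ) (P : Measure Ω) : Prop :=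
  ∀ᵐ ω ∂P, ContinuousOn (fun p => U p ω) D

/-- The function `(|l| / 2)^ρ + |½ ∑_{k=1}^N a_k l^{2k+1} (-1)^k|^ρ`. -/
def holderWeight (N : ℕ) (coef : ℕ → ℝ) (ρ l : ℝ) : ℝ :=
  (|l| / 2) ^ ρ + |1 / 2 * dispersionPoly N coef l| ^ ρ

/-- The constant `C_Z ∈ [0, ∞]` for `Z(u) = u ^ ρ`. -/
def constCZ (Γ : ℝ → ℝ → ℝ) (N : ℕ) (coef : ℕ → ℝ) (ρ : ℝ) : ℝ≥0∞ :=
  (variationIntegral Γ fun l m =>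
    ENNReal.ofReal (holderWeight N coef ρ l * holderWeight N coef ρ m)) ^ (1 / 2 : ℝ)

/-- `ε₀ = sup_{(t, x) ∈ D} τ_φ(U(t, x))`. -/
def supStandard {Ω : Type*} [MeasurableSpace Ω] (φ : ℝ → ℝ) (D : Set (ℝ × ℝ))
    (U : ℝ × ℝ → Ω → ℝ) (P : Measure Ω) : ℝ≥0∞ :=
  ⨆ p ∈ D, subGaussianStandard φ (U p) P

end

/-!
In `L²(P)` the process `y` is a curve whose Gram kernel is `Γ_y`, so `U(t, x)` is a Stieltjes
integral along a curve, and expanding squares of Riemann-Stieltjes sums gives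
`‖∫ f dy‖² ≤ ∬ |f(l) f(m)| d|Γ_y(l, m)|`. Strict `φ`-sub-Gaussianity passes to mean-square limits,
hence `τ_φ(∫ f dy) ≤ C_y ‖∫ f dy‖`. For `f = I(t, x, ·) - I(t₁, x₁, ·)` the chord bound
`|κ u - κ v| ≤ 2 |sin ((u - v) / 2)|` and `|sin (A + B)| ≤ |A| ^ ρ + |B| ^ ρ` give
`|f| ≤ 2 h ^ ρ` times the weight in `C_Z`, so `U` is `ρ`-Hölder with respect to `τ_φ`; since that
weight is `O(1 + |l| ^ ((2 N + 1) ρ))`, the Hölder constant is finite.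

A field which is Hölder with respect to `τ_φ` has a continuous modification, the limit of its
averages over finer and finer nets. Its supremum is a sum of increments along a chain of nets, and
`E exp (l sup |U|)` is bounded by Hölder's inequality along the chain. The weights and the mesh of
the nets are chosen so that the entropy terms add up to the power `2 / ρ`.
-/

/-! ### Stieltjes integrals along a curve in a Hilbert space -/

/-- A partition `A = s₀ ≤ ⋯ ≤ sₙ = B` with a tag in each of its cells. Points and tags are
sequences; only `point i` for `i ≤ card` and `tag i` for `i < card` matter. -/
structure TaggedPartition (A B : ℝ) where
  card : ℕ
  point : ℕ → ℝ
  tag : ℕ → ℝ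
  monotone_point : Monotone point
  point_zero : point 0 = A
  point_card : point card = B
  tag_mem_Icc : ∀ i < card, tag i ∈ Icc (point i) (point (i + 1))

namespace TaggedPartition

variable {A B C δ : ℝ}

/-- All cells of the partition are shorter than `δ`. -/
def MeshLT (π : TaggedPartition A B) (δ : ℝ) : Prop :=
  ∀ i < π.card, π.point (i + 1) - π.point i < δ

/-- The filter of tagged partitions of `[A, B]` whose mesh tends to `0`. -/
def fine (A B : ℝ) : Filter (TaggedPartition A B) :=
  ⨅ δ ∈ Ioi (0 : ℝ), 𝓟 {π | π.MeshLT δ}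

lemma hasBasis_fine (A B : ℝ) :
    (fine A B).HasBasis (fun δ : ℝ => 0 < δ) fun δ => {π | π.MeshLT δ} := by
  refine hasBasis_biInf_principal
    (fun δ hδ δ' hδ' => ⟨min δ δ', mem_Ioi.2 (lt_min hδ hδ'), ?_, ?_⟩) ⟨1, zero_lt_one (α := ℝ)⟩
  · exact fun π hπ i hi => (hπ i hi).trans_le (min_le_left _ _)
  · exact fun π hπ i hi => (hπ i hi).trans_le (min_le_right _ _)

lemma point_mem_Icc (π : TaggedPartition A B) {i : ℕ} (hi : i ≤ π.card) :
    π.point i ∈ Icc A B :=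
  ⟨π.point_zero.symm.trans_le (π.monotone_point i.zero_le),
    (π.monotone_point hi).trans_eq π.point_card⟩

lemma cell_subset_Icc (π : TaggedPartition A B) {i : ℕ} (hi : i < π.card) :
    Icc (π.point i) (π.point (i + 1)) ⊆ Icc A B :=
  Icc_subset_Icc (π.point_mem_Icc hi.le).1 (π.point_mem_Icc hi).2

lemma exists_meshLT (hAB : A ≤ B) (hδ : 0 < δ) : ∃ π : TaggedPartition A B, π.MeshLT δ := by
  obtain ⟨n, hn⟩ := exists_nat_ge ((B - A) / (δ / 2))
  have hBn : B ≤ A + n * (δ / 2) := by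
    rw [div_le_iff₀ (by positivity)] at hn
    linarith
  have hmono : Monotone fun i : ℕ => min B (A + i * (δ / 2)) := fun i j hij => by
    dsimp only
    gcongr
  refine ⟨⟨n, fun i => min B (A + i * (δ / 2)), fun i => min B (A + i * (δ / 2)), hmono,
    by simpa using hAB, min_eq_left hBn, fun i _ => ⟨le_rfl, hmono i.le_succ⟩⟩, fun i _ => ?_⟩
  rcases min_cases B (A + i * (δ / 2)) with h | h <;>
    have := min_le_left B (A + (i + 1 : ℕ) * (δ / 2)) <;>
    have := min_le_right B (A + (i + 1 : ℕ) * (δ / 2)) <;>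
    push_cast at * <;> linarith

lemma fine_neBot (hAB : A ≤ B) : (fine A B).NeBot :=
  (hasBasis_fine A B).neBot_iff.2 fun hδ => exists_meshLT hAB hδ

/-- The partition of `[A, C]` formed by one of `[A, B]` followed by one of `[B, C]`. -/
def concat (π : TaggedPartition A B) (π' : TaggedPartition B C) : TaggedPartition A C where
  card := π.card + π'.card
  point i := if i < π.card then π.point i else π'.point (i - π.card)
  tag i := if i < π.card then π.tag i else π'.tag (i - π.card)
  monotone_point := by
    intro i j hij
    dsimp only
    split_ifs with hi hj hj
    · exact π.monotone_point hij
    · exact (π.point_mem_Icc hi.le).2.trans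
        (π'.point_zero.symm.trans_le (π'.monotone_point (Nat.zero_le _)))
    · omega
    · exact π'.monotone_point (by omega)
  point_zero := by
    rcases Nat.eq_zero_or_pos π.card with h | h
    · simpa [h, π'.point_zero, π.point_zero] using π.point_card.symm
    · simp [h, π.point_zero]
  point_card := by simp [π'.point_card]
  tag_mem_Icc i hi := by
    rcases lt_trichotomy (i + 1) π.card with h | h | h
    · simpa [h, (Nat.lt_succ_self i).trans h] using π.tag_mem_Icc i (by omega)
    · have := π.tag_mem_Icc i (by omega)
      simpa [h, show i < π.card by omega, π'.point_zero, π.point_card] using this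
    · have := π'.tag_mem_Icc (i - π.card) (by omega)
      rw [if_neg (by omega), if_neg (by omega), if_neg (by omega), Nat.succ_sub (by omega)]
      exact this

lemma tendsto_concat :
    Tendsto (fun p : TaggedPartition A B × TaggedPartition B C => p.1.concat p.2)
      (fine A B ×ˢ fine B C) (fine A C) := by
  refine (((hasBasis_fine A B).prod_same_index (hasBasis_fine B C) ?_).tendsto_iff
    (hasBasis_fine A C)).2 fun δ hδ => ⟨δ, hδ, ?_⟩
  · intro δ δ' hδ hδ'
    exact ⟨min δ δ', lt_min hδ hδ', fun π hπ i hi => (hπ i hi).trans_le (min_le_left _ _),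
      fun π hπ i hi => (hπ i hi).trans_le (min_le_right _ _)⟩
  rintro ⟨π, π'⟩ ⟨hπ : π.MeshLT δ, hπ' : π'.MeshLT δ⟩ i (hi : i < π.card + π'.card)
  dsimp only [concat]
  rcases lt_trichotomy (i + 1) π.card with h | h | h
  · simpa [h, (Nat.lt_succ_self i).trans h] using hπ i (by omega)
  · have := hπ i (by omega)
    simpa [h, show i < π.card by omega, π'.point_zero, π.point_card] using this
  · have := hπ' (i - π.card) (by omega)
    rw [if_neg (by omega), if_neg (by omega), Nat.succ_sub (by omega)]
    exact this

end TaggedPartition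

section RefinedGrid

/-- The point of `[p, q]` nearest to `x`. -/
noncomputable def clampTo (p q x : ℝ) : ℝ := max p (min q x)

lemma clampTo_of_le_left {p q x : ℝ} (hpq : p ≤ q) (h : x ≤ p) : clampTo p q x = p := by
  rw [clampTo, min_eq_right (h.trans hpq), max_eq_left h]

lemma clampTo_of_right_le {p q x : ℝ} (hpq : p ≤ q) (h : q ≤ x) : clampTo p q x = q := by
  rw [clampTo, min_eq_left h, max_eq_right hpq]

lemma clampTo_sub_clampTo_comm {G : Type*} [AddCommGroup G] (Y : ℝ → G) {p p' q q' : ℝ}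
    (hp : p ≤ p') (hq : q ≤ q') :
    Y (clampTo p p' q') - Y (clampTo p p' q) = Y (clampTo q q' p') - Y (clampTo q q' p) := by
  rcases le_total p' q with h | h
  · rw [clampTo_of_right_le hp h, clampTo_of_right_le hp (h.trans hq), clampTo_of_le_left hq h,
      clampTo_of_le_left hq (hp.trans h), sub_self, sub_self]
  rcases le_total q' p with h' | h'
  · rw [clampTo_of_le_left hp h', clampTo_of_le_left hp (hq.trans h'), clampTo_of_right_le hq h',
      clampTo_of_right_le hq (h'.trans hp), sub_self, sub_self]
  · have : max p (min p' q') = max q (min q' p') := by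
      rw [max_eq_right (le_min hp h'), max_eq_right (le_min hq h), min_comm]
    simp only [clampTo, this, min_eq_right h, min_eq_right h', max_comm p]

lemma sum_sub_clampTo {G : Type*} [AddCommGroup G] (Y : ℝ → G) {p q : ℝ} {r : ℕ → ℝ} {m : ℕ}
    (hp : r 0 ≤ p) (hpq : p ≤ q) (hq : q ≤ r m) :
    ∑ j ∈ Finset.range m, (Y (clampTo p q (r (j + 1))) - Y (clampTo p q (r j))) = Y q - Y p := by
  rw [Finset.sum_range_sub (fun j => Y (clampTo p q (r j))), clampTo_of_le_left hpq hp,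
    clampTo_of_right_le hpq hq]

/-- The common refinement of two grids `s` and `r`, the latter with `m` cells, enumerated
lexicographically: its cell `p` is the intersection of the cells `p / m` of `s` and `p % m` of
`r`, collapsed to an end point of the former if these are disjoint. -/
noncomputable def refinedGrid (s r : ℕ → ℝ) (m p : ℕ) : ℝ :=
  clampTo (s (p / m)) (s (p / m + 1)) (r (p % m))

lemma succ_div_mod_cases (p : ℕ) {m : ℕ} (hm : 0 < m) :
    ((p + 1) / m = p / m ∧ (p + 1) % m = p % m + 1) ∨
      ((p + 1) / m = p / m + 1 ∧ (p + 1) % m = 0 ∧ p % m + 1 = m) := by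
  have hp := Nat.div_add_mod p m
  rcases Nat.lt_or_ge (p % m + 1) m with h | h
  · left
    rw [Nat.div_mod_unique hm]
    exact ⟨by omega, h⟩
  · right
    have hlt := Nat.mod_lt p hm
    rw [← and_assoc, Nat.div_mod_unique hm, Nat.mul_add]
    omega

lemma monotone_refinedGrid {s r : ℕ → ℝ} (hs : Monotone s) (hr : Monotone r) {m : ℕ}
    (hm : 0 < m) : Monotone (refinedGrid s r m) := by
  refine monotone_nat_of_le_succ fun p => ?_
  unfold refinedGrid
  rcases succ_div_mod_cases p hm with ⟨hd, hmod⟩ | ⟨hd, -, -⟩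
  · rw [hd, hmod]
    exact max_le_max le_rfl (min_le_min le_rfl (hr (Nat.le_succ _)))
  · rw [hd]
    exact (max_le (hs (Nat.le_succ _)) (min_le_left _ _)).trans (le_max_left _ _)

lemma refinedGrid_succ {s r : ℕ → ℝ} (hs : Monotone s) {m p : ℕ} (hm : 0 < m)
    (h₀ : r 0 ≤ s (p / m)) (h₁ : s (p / m + 1) ≤ r m) :
    refinedGrid s r m (p + 1) = clampTo (s (p / m)) (s (p / m + 1)) (r (p % m + 1)) := by
  unfold refinedGrid
  rcases succ_div_mod_cases p hm with ⟨hd, hmod⟩ | ⟨hd, hmod, hlast⟩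
  · rw [hd, hmod]
  · have hle := hs (Nat.le_succ (p / m))
    rw [hd, hmod, hlast, clampTo_of_right_le hle h₁,
      clampTo_of_le_left (hs (Nat.le_succ _)) (h₀.trans hle)]

lemma sum_range_mul_div_mod {G : Type*} [AddCommMonoid G] (F : ℕ → ℕ → G) (n m : ℕ) :
    ∑ p ∈ Finset.range (n * m), F (p / m) (p % m) =
      ∑ i ∈ Finset.range n, ∑ j ∈ Finset.range m, F i j := by
  simp_rw [Finset.sum_range, ← Fintype.sum_prod_type']
  exact Fintype.sum_equiv finProdFinEquiv.symm _ _ fun _ => rfl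

end RefinedGrid

section StieltjesSum

variable {H : Type*} [NormedAddCommGroup H] [InnerProductSpace ℝ H]

/-- The kernel `⟪Y s, Y t⟫` of a curve in a Hilbert space, the covariance function when `Y` is a
second-order process. -/
noncomputable def gramKernel (Y : ℝ → H) (s t : ℝ) : ℝ := inner ℝ (Y s) (Y t)

/-- The sums in the definition of the Vitali variation of `Γ` are at most `V`. -/
def VitaliVariationLE (Γ : ℝ → ℝ → ℝ) (V : ℝ) : Prop :=
  ∀ (n m : ℕ) (s t : ℕ → ℝ), Monotone s → Monotone t →
    ∑ i ∈ Finset.range n, ∑ j ∈ Finset.range m,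
      |rectIncrement Γ (s i) (s (i + 1)) (t j) (t (j + 1))| ≤ V

/-- The Riemann-Stieltjes sum of `f` with respect to `Y`. -/
noncomputable def stieltjesSum (f : ℝ → ℝ) (Y : ℝ → H) {A B : ℝ} (π : TaggedPartition A B) : H :=
  ∑ i ∈ Finset.range π.card, f (π.tag i) • (Y (π.point (i + 1)) - Y (π.point i))

lemma inner_sub_sub_eq_rectIncrement (Y : ℝ → H) (s s' t t' : ℝ) :
    inner ℝ (Y s' - Y s) (Y t' - Y t) = rectIncrement (gramKernel Y) s s' t t' := by
  simp only [rectIncrement, gramKernel, inner_sub_left, inner_sub_right]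
  ring

lemma norm_sq_sum_smul_sub_le (Y : ℝ → H) (n : ℕ) (s c : ℕ → ℝ) :
    ‖∑ i ∈ Finset.range n, c i • (Y (s (i + 1)) - Y (s i))‖ ^ 2 ≤
      ∑ i ∈ Finset.range n, ∑ j ∈ Finset.range n, |c i| * |c j| *
        |rectIncrement (gramKernel Y) (s i) (s (i + 1)) (s j) (s (j + 1))| := by
  rw [← real_inner_self_eq_norm_sq, sum_inner]
  gcongr with i _
  rw [inner_sum]
  gcongr with j _
  rw [real_inner_smul_left, real_inner_smul_right, inner_sub_sub_eq_rectIncrement, ← mul_assoc,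
    ← abs_mul, ← abs_mul]
  exact le_abs_self _

lemma norm_sum_smul_sub_le {Y : ℝ → H} {V : ℝ} (hV : VitaliVariationLE (gramKernel Y) V)
    {n : ℕ} {s c : ℕ → ℝ} (hs : Monotone s) {M : ℝ} (hM : 0 ≤ M) (hc : ∀ i < n, |c i| ≤ M) :
    ‖∑ i ∈ Finset.range n, c i • (Y (s (i + 1)) - Y (s i))‖ ≤ M * √V := by
  rw [← Real.sqrt_sq hM, ← Real.sqrt_mul (sq_nonneg M)]
  refine Real.le_sqrt_of_sq_le ((norm_sq_sum_smul_sub_le Y n s c).trans ?_)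
  refine le_trans ?_ (mul_le_mul_of_nonneg_left (hV n n s s hs hs) (sq_nonneg M))
  simp_rw [Finset.mul_sum, sq]
  gcongr with i hi j hj
  exacts [hc i (Finset.mem_range.1 hi), hc j (Finset.mem_range.1 hj)]

variable {A B : ℝ}

lemma stieltjesSum_eq_sum_clampTo (f : ℝ → ℝ) (Y : ℝ → H) (π π' : TaggedPartition A B) :
    stieltjesSum f Y π = ∑ i ∈ Finset.range π.card, ∑ j ∈ Finset.range π'.card, f (π.tag i) •
      (Y (clampTo (π.point i) (π.point (i + 1)) (π'.point (j + 1))) -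
        Y (clampTo (π.point i) (π.point (i + 1)) (π'.point j))) := by
  refine Finset.sum_congr rfl fun i hi => ?_
  rw [Finset.mem_range] at hi
  rw [← Finset.smul_sum, sum_sub_clampTo Y _ (π.monotone_point i.le_succ)]
  · exact π'.point_card.symm ▸ (π.point_mem_Icc hi).2
  · exact π'.point_zero.symm ▸ (π.point_mem_Icc hi.le).1

lemma stieltjesSum_eq_sum_clampTo' (f : ℝ → ℝ) (Y : ℝ → H) (π π' : TaggedPartition A B) :
    stieltjesSum f Y π' = ∑ i ∈ Finset.range π.card, ∑ j ∈ Finset.range π'.card, f (π'.tag j) •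
      (Y (clampTo (π.point i) (π.point (i + 1)) (π'.point (j + 1))) -
        Y (clampTo (π.point i) (π.point (i + 1)) (π'.point j))) := by
  rw [stieltjesSum_eq_sum_clampTo f Y π' π, Finset.sum_comm]
  refine Finset.sum_congr rfl fun i _ => Finset.sum_congr rfl fun j _ => ?_
  rw [clampTo_sub_clampTo_comm Y (π'.monotone_point j.le_succ) (π.monotone_point i.le_succ)]

/-- The difference of the values of `f` at the tags of the cells `i` of `π` and `j` of `π'` if
these cells meet, and `0` otherwise. -/
noncomputable def tagDifference (f : ℝ → ℝ) (π π' : TaggedPartition A B) (i j : ℕ) : ℝ :=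
  if π.point (i + 1) ≤ π'.point j ∨ π'.point (j + 1) ≤ π.point i then 0
  else f (π.tag i) - f (π'.tag j)

lemma stieltjesSum_sub_stieltjesSum (f : ℝ → ℝ) (Y : ℝ → H) (π π' : TaggedPartition A B) :
    stieltjesSum f Y π - stieltjesSum f Y π' =
      ∑ p ∈ Finset.range (π.card * π'.card),
        tagDifference f π π' (p / π'.card) (p % π'.card) •
          (Y (refinedGrid π.point π'.point π'.card (p + 1)) -
            Y (refinedGrid π.point π'.point π'.card p)) := by
  have hcell (p) (hp : p ∈ Finset.range (π.card * π'.card)) :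
      refinedGrid π.point π'.point π'.card (p + 1) =
        clampTo (π.point (p / π'.card)) (π.point (p / π'.card + 1))
          (π'.point (p % π'.card + 1)) := by
    rw [Finset.mem_range] at hp
    have hm : 0 < π'.card := Nat.pos_of_mul_pos_left (p.zero_le.trans_lt hp)
    have hpn : p / π'.card < π.card := (Nat.div_lt_iff_lt_mul hm).2 hp
    refine refinedGrid_succ π.monotone_point hm ?_ ?_
    · exact π'.point_zero.symm ▸ (π.point_mem_Icc hpn.le).1
    · exact π'.point_card.symm ▸ (π.point_mem_Icc hpn).2
  rw [Finset.sum_congr rfl fun p hp => by rw [hcell p hp, refinedGrid],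
    sum_range_mul_div_mod fun i j => tagDifference f π π' i j •
      (Y (clampTo (π.point i) (π.point (i + 1)) (π'.point (j + 1))) -
        Y (clampTo (π.point i) (π.point (i + 1)) (π'.point j))),
    stieltjesSum_eq_sum_clampTo f Y π π', stieltjesSum_eq_sum_clampTo' f Y π π']
  simp_rw [← Finset.sum_sub_distrib, ← sub_smul]
  refine Finset.sum_congr rfl fun i _ => Finset.sum_congr rfl fun j _ => ?_
  have hi := π.monotone_point i.le_succ
  have hj := π'.monotone_point j.le_succ
  unfold tagDifference
  split_ifs with h
  · rcases h with h | h
    · rw [clampTo_of_right_le hi h, clampTo_of_right_le hi (h.trans hj), sub_self, smul_zero,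
        smul_zero]
    · rw [clampTo_of_le_left hi h, clampTo_of_le_left hi (hj.trans h), sub_self, smul_zero,
        smul_zero]
  · rfl

lemma norm_stieltjesSum_sub_le {Y : ℝ → H} {V : ℝ} (hV : VitaliVariationLE (gramKernel Y) V)
    {f : ℝ → ℝ} {δ η : ℝ} (hη : 0 ≤ η)
    (hf : ∀ x ∈ Icc A B, ∀ x' ∈ Icc A B, |x - x'| < 2 * δ → |f x - f x'| ≤ η)
    {π π' : TaggedPartition A B} (hπ : π.MeshLT δ) (hπ' : π'.MeshLT δ) :
    ‖stieltjesSum f Y π - stieltjesSum f Y π'‖ ≤ η * √V := by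
  rcases Nat.eq_zero_or_pos π'.card with hm | hm
  · rw [stieltjesSum_sub_stieltjesSum, hm, mul_zero, Finset.sum_range_zero, norm_zero]
    positivity
  rw [stieltjesSum_sub_stieltjesSum]
  refine norm_sum_smul_sub_le hV
    (monotone_refinedGrid π.monotone_point π'.monotone_point hm) hη fun p hp => ?_
  have hi : p / π'.card < π.card := (Nat.div_lt_iff_lt_mul hm).2 hp
  have hj : p % π'.card < π'.card := Nat.mod_lt p hm
  generalize p / π'.card = i at hi
  generalize p % π'.card = j at hj
  unfold tagDifference
  split_ifs with h
  · rwa [abs_zero]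
  have hi_tag := π.tag_mem_Icc i hi
  have hj_tag := π'.tag_mem_Icc j hj
  refine hf _ (π.cell_subset_Icc hi hi_tag) _ (π'.cell_subset_Icc hj hj_tag) ?_
  rw [abs_lt]
  push Not at h
  constructor <;> linarith [hi_tag.1, hi_tag.2, hj_tag.1, hj_tag.2, hπ i hi, hπ' j hj]

end StieltjesSum

section StieltjesIntegral

variable {H : Type*} [NormedAddCommGroup H] [InnerProductSpace ℝ H]

/-- `J = ∫_A^B f dY`, the limit of Riemann-Stieltjes sums as the mesh tends to `0`. -/
def IsStieltjesIntegralOn (f : ℝ → ℝ) (Y : ℝ → H) (A B : ℝ) (J : H) : Prop :=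
  Tendsto (stieltjesSum f Y) (TaggedPartition.fine A B) (𝓝 J)

variable {Y : ℝ → H} {f g : ℝ → ℝ} {A B C V : ℝ} {J J' : H}

lemma stieltjesSum_sub_fun (π : TaggedPartition A B) :
    stieltjesSum (fun l => f l - g l) Y π = stieltjesSum f Y π - stieltjesSum g Y π := by
  simp only [stieltjesSum, sub_smul, Finset.sum_sub_distrib]

lemma stieltjesSum_concat (π : TaggedPartition A B) (π' : TaggedPartition B C) :
    stieltjesSum f Y (π.concat π') = stieltjesSum f Y π + stieltjesSum f Y π' := by
  simp only [stieltjesSum, TaggedPartition.concat, Finset.sum_range_add]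
  congr 1
  · refine Finset.sum_congr rfl fun i hi => ?_
    rw [Finset.mem_range] at hi
    rcases (Nat.succ_le_of_lt hi).lt_or_eq with h | h
    · simp only [hi, h, if_true]
    · have hi' : i + 1 = π.card := h
      simp only [hi, hi', if_true, lt_irrefl, if_false, tsub_self, π'.point_zero, π.point_card]
  · refine Finset.sum_congr rfl fun i _ => ?_
    simp only [add_assoc, add_lt_iff_neg_left, not_lt_zero, if_false, add_tsub_cancel_left]

namespace IsStieltjesIntegralOn

lemma sub (hf : IsStieltjesIntegralOn f Y A B J) (hg : IsStieltjesIntegralOn g Y A B J') :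
    IsStieltjesIntegralOn (fun l => f l - g l) Y A B (J - J') :=
  (Tendsto.sub hf hg).congr fun π => (stieltjesSum_sub_fun π).symm

lemma eq_add {J'' : H} (hAB : A ≤ B) (hBC : B ≤ C) (h : IsStieltjesIntegralOn f Y A C J)
    (h' : IsStieltjesIntegralOn f Y A B J') (h'' : IsStieltjesIntegralOn f Y B C J'') :
    J = J' + J'' := by
  have := TaggedPartition.fine_neBot hAB
  have := TaggedPartition.fine_neBot hBC
  refine tendsto_nhds_unique (l := TaggedPartition.fine A B ×ˢ TaggedPartition.fine B C)
    (Tendsto.comp h TaggedPartition.tendsto_concat) ?_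
  refine ((h'.comp tendsto_fst).add (h''.comp tendsto_snd)).congr fun p => ?_
  exact (stieltjesSum_concat p.1 p.2).symm

lemma mem_closure_span (hAB : A ≤ B) (h : IsStieltjesIntegralOn f Y A B J) :
    J ∈ closure (Submodule.span ℝ (range Y) : Set H) := by
  have := TaggedPartition.fine_neBot hAB
  refine mem_closure_of_tendsto h (Eventually.of_forall fun π => ?_)
  exact Submodule.sum_mem _ fun i _ => Submodule.smul_mem _ _ (Submodule.sub_mem _
    (Submodule.subset_span (mem_range_self _)) (Submodule.subset_span (mem_range_self _)))

end IsStieltjesIntegralOn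

lemma exists_isStieltjesIntegralOn [CompleteSpace H] (hV : VitaliVariationLE (gramKernel Y) V)
    (hf : ContinuousOn f (Icc A B)) (hAB : A ≤ B) : ∃ J, IsStieltjesIntegralOn f Y A B J := by
  have := TaggedPartition.fine_neBot hAB
  refine cauchy_map_iff_exists_tendsto.1 (Metric.cauchy_iff.2 ⟨inferInstance, fun ε hε => ?_⟩)
  have hη : 0 < ε / (√V + 1) := by positivity
  obtain ⟨δ, hδ, hfδ⟩ := Metric.uniformContinuousOn_iff_le.1
    (isCompact_Icc.uniformContinuousOn_of_continuous hf) _ hη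
  refine ⟨_, image_mem_map ((TaggedPartition.hasBasis_fine A B).mem_of_mem (half_pos hδ)), ?_⟩
  rintro _ ⟨π, hπ, rfl⟩ _ ⟨π', hπ', rfl⟩
  rw [dist_eq_norm]
  refine (norm_stieltjesSum_sub_le hV hη.le (fun x hx x' hx' hxx => ?_) hπ hπ').trans_lt ?_
  · exact hfδ x hx x' hx' (by rw [Real.dist_eq]; linarith)
  · rw [div_mul_eq_mul_div, div_lt_iff₀ (by positivity)]
    gcongr
    exact lt_add_one _

end StieltjesIntegral

section VariationIntegral

variable {Γ : ℝ → ℝ → ℝ} {F : ℝ → ℝ → ℝ≥0∞}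

lemma sum_iInf_mul_le_variationIntegral (F : ℝ → ℝ → ℝ≥0∞) (n m : ℕ) {s t : ℕ → ℝ}
    (hs : Monotone s) (ht : Monotone t) :
    ∑ i ∈ Finset.range n, ∑ j ∈ Finset.range m,
      (⨅ (u ∈ Icc (s i) (s (i + 1))) (v ∈ Icc (t j) (t (j + 1))), F u v) *
        ENNReal.ofReal |rectIncrement Γ (s i) (s (i + 1)) (t j) (t (j + 1))|
      ≤ variationIntegral Γ F :=
  le_iSup₂_of_le n m <| le_iSup₂_of_le s t <| le_iSup₂_of_le hs ht le_rfl

lemma variationIntegral_const_mul {c : ℝ≥0∞} (hc₀ : c ≠ 0) (hc : c ≠ ∞) :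
    variationIntegral Γ (fun l m => c * F l m) = c * variationIntegral Γ F := by
  simp only [variationIntegral, ENNReal.mul_iSup, Finset.mul_sum, ← ENNReal.mul_iInf_of_ne hc₀ hc,
    mul_assoc]

lemma sum_rectIncrement_le_ofReal {V : ℝ} (hV : VitaliVariationLE Γ V) (n m : ℕ) {s t : ℕ → ℝ}
    (hs : Monotone s) (ht : Monotone t) :
    ∑ i ∈ Finset.range n, ∑ j ∈ Finset.range m,
      ENNReal.ofReal |rectIncrement Γ (s i) (s (i + 1)) (t j) (t (j + 1))| ≤ ENNReal.ofReal V := by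
  refine le_trans (le_of_eq ?_) (ENNReal.ofReal_le_ofReal (hV n m s t hs ht))
  rw [ENNReal.ofReal_sum_of_nonneg fun _ _ => by positivity]
  exact Finset.sum_congr rfl fun _ _ => (ENNReal.ofReal_sum_of_nonneg fun _ _ => abs_nonneg _).symm

lemma variationIntegral_one_le {V : ℝ} (hV : VitaliVariationLE Γ V) :
    variationIntegral Γ (fun _ _ => 1) ≤ ENNReal.ofReal V := by
  refine iSup₂_le fun n m => iSup₂_le fun s t => iSup₂_le fun hs ht => ?_
  refine le_trans ?_ (sum_rectIncrement_le_ofReal hV n m hs ht)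
  gcongr with i _ j _
  refine mul_le_of_le_one_left' ?_
  exact iInf₂_le_of_le _ (left_mem_Icc.2 (hs i.le_succ))
    (iInf₂_le _ (left_mem_Icc.2 (ht j.le_succ)))

end VariationIntegral

section NormBound

variable {H : Type*} [NormedAddCommGroup H] [InnerProductSpace ℝ H]
  {Y : ℝ → H} {f : ℝ → ℝ} {A B V : ℝ} {J : H} {F : ℝ → ℝ → ℝ≥0∞}

lemma enorm_sq_stieltjesSum_le (f : ℝ → ℝ) (Y : ℝ → H) (π : TaggedPartition A B) :
    ‖stieltjesSum f Y π‖ₑ ^ 2 ≤ ∑ i ∈ Finset.range π.card, ∑ j ∈ Finset.range π.card,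
      ENNReal.ofReal (|f (π.tag i)| * |f (π.tag j)|) *
        ENNReal.ofReal |rectIncrement (gramKernel Y) (π.point i) (π.point (i + 1))
          (π.point j) (π.point (j + 1))| := by
  rw [← ofReal_norm, ← ENNReal.ofReal_pow (norm_nonneg _)]
  refine (ENNReal.ofReal_le_ofReal (norm_sq_sum_smul_sub_le Y π.card π.point _)).trans_eq ?_
  rw [ENNReal.ofReal_sum_of_nonneg fun _ _ => by positivity]
  refine Finset.sum_congr rfl fun i _ => ?_
  rw [ENNReal.ofReal_sum_of_nonneg fun _ _ => by positivity]
  exact Finset.sum_congr rfl fun j _ => ENNReal.ofReal_mul (by positivity)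

lemma eventually_mul_tag_le (hf : ContinuousOn f (Icc A B)) {η : ℝ} (hη : 0 < η) :
    ∀ᶠ π : TaggedPartition A B in TaggedPartition.fine A B, ∀ i < π.card, ∀ j < π.card,
      ∀ u ∈ Icc (π.point i) (π.point (i + 1)), ∀ v ∈ Icc (π.point j) (π.point (j + 1)),
        |f (π.tag i)| * |f (π.tag j)| ≤ |f u| * |f v| + η := by
  have hcont : ContinuousOn (fun p : ℝ × ℝ => |f p.1| * |f p.2|) (Icc A B ×ˢ Icc A B) :=
    (hf.comp continuousOn_fst fun _ hp => hp.1).abs.mul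
      (hf.comp continuousOn_snd fun _ hp => hp.2).abs
  obtain ⟨δ, hδ, hfδ⟩ := Metric.uniformContinuousOn_iff_le.1
    ((isCompact_Icc.prod isCompact_Icc).uniformContinuousOn_of_continuous hcont) η hη
  filter_upwards [(TaggedPartition.hasBasis_fine A B).mem_of_mem hδ] with π hπ i hi j hj u hu v hv
  have hmesh {i : ℕ} (hi : i < π.card) {u : ℝ} (hu : u ∈ Icc (π.point i) (π.point (i + 1))) :
      dist (π.tag i) u ≤ δ :=
    (Real.dist_le_of_mem_Icc (π.tag_mem_Icc i hi) hu).trans (hπ i hi).le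
  have hdist := hfδ (π.tag i, π.tag j)
    ⟨π.cell_subset_Icc hi (π.tag_mem_Icc i hi), π.cell_subset_Icc hj (π.tag_mem_Icc j hj)⟩
    (u, v) ⟨π.cell_subset_Icc hi hu, π.cell_subset_Icc hj hv⟩ (max_le (hmesh hi hu) (hmesh hj hv))
  rw [Real.dist_eq] at hdist
  linarith [le_abs_self (|f (π.tag i)| * |f (π.tag j)| - |f u| * |f v|)]

lemma eventually_enorm_sq_stieltjesSum_le (hV : VitaliVariationLE (gramKernel Y) V)
    (hf : ContinuousOn f (Icc A B))
    (hF : ∀ l ∈ Icc A B, ∀ m ∈ Icc A B, ENNReal.ofReal (|f l| * |f m|) ≤ F l m)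
    {η : ℝ} (hη : 0 < η) :
    ∀ᶠ π : TaggedPartition A B in TaggedPartition.fine A B, ‖stieltjesSum f Y π‖ₑ ^ 2 ≤
      variationIntegral (gramKernel Y) F + ENNReal.ofReal η * ENNReal.ofReal V := by
  filter_upwards [eventually_mul_tag_le hf hη] with π hπ
  calc ‖stieltjesSum f Y π‖ₑ ^ 2
    _ ≤ _ := enorm_sq_stieltjesSum_le f Y π
    _ ≤ ∑ i ∈ Finset.range π.card, ∑ j ∈ Finset.range π.card,
          ((⨅ (u ∈ Icc (π.point i) (π.point (i + 1)))
              (v ∈ Icc (π.point j) (π.point (j + 1))), F u v) + ENNReal.ofReal η) *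
          ENNReal.ofReal |rectIncrement (gramKernel Y) (π.point i) (π.point (i + 1))
            (π.point j) (π.point (j + 1))| := by
      gcongr with i hi j hj
      rw [Finset.mem_range] at hi hj
      rw [← tsub_le_iff_right]
      refine le_iInf₂ fun u hu => le_iInf₂ fun v hv => ?_
      refine le_trans ?_ (hF u (π.cell_subset_Icc hi hu) v (π.cell_subset_Icc hj hv))
      rw [tsub_le_iff_right, ← ENNReal.ofReal_add (by positivity) hη.le]
      exact ENNReal.ofReal_le_ofReal (hπ i hi j hj u hu v hv)
    _ ≤ _ := by
      simp only [add_mul, Finset.sum_add_distrib, ← Finset.mul_sum]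
      gcongr
      · exact sum_iInf_mul_le_variationIntegral F _ _ π.monotone_point π.monotone_point
      · exact sum_rectIncrement_le_ofReal hV _ _ π.monotone_point π.monotone_point

lemma IsStieltjesIntegralOn.enorm_sq_le (h : IsStieltjesIntegralOn f Y A B J)
    (hV : VitaliVariationLE (gramKernel Y) V) (hf : ContinuousOn f (Icc A B)) (hAB : A ≤ B)
    (hF : ∀ l ∈ Icc A B, ∀ m ∈ Icc A B, ENNReal.ofReal (|f l| * |f m|) ≤ F l m) :
    ‖J‖ₑ ^ 2 ≤ variationIntegral (gramKernel Y) F := by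
  have := TaggedPartition.fine_neBot hAB
  have hJ : Tendsto (fun π => ‖stieltjesSum f Y π‖ₑ ^ 2) (TaggedPartition.fine A B)
      (𝓝 (‖J‖ₑ ^ 2)) := (ENNReal.continuous_pow 2).continuousAt.tendsto.comp h.enorm
  have hη : ∀ᶠ η in 𝓝[>] (0 : ℝ), ‖J‖ₑ ^ 2 ≤
      variationIntegral (gramKernel Y) F + ENNReal.ofReal η * ENNReal.ofReal V := by
    filter_upwards [self_mem_nhdsWithin] with η hη
    exact le_of_tendsto hJ (eventually_enorm_sq_stieltjesSum_le hV hf hF hη)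
  refine ge_of_tendsto (Tendsto.mono_left ?_ nhdsWithin_le_nhds) hη
  have hlim : Tendsto (fun η => ENNReal.ofReal η * ENNReal.ofReal V) (𝓝 0)
      (𝓝 (ENNReal.ofReal 0 * ENNReal.ofReal V)) :=
    ENNReal.Tendsto.mul_const (ENNReal.tendsto_ofReal tendsto_id) (.inr ENNReal.ofReal_ne_top)
  simpa using hlim.const_add (variationIntegral (gramKernel Y) F)

end NormBound

section ImproperIntegral

/-- The seminorm `(∬ g(l) g(m) d|Γ(l, m)|)^{1/2}` of a weight `g ≥ 0`, which bounds Stieltjes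
integrals along a curve with Gram kernel `Γ`. -/
noncomputable def variationNorm (Γ : ℝ → ℝ → ℝ) (g : ℝ → ℝ) : ℝ≥0∞ :=
  (variationIntegral Γ fun l m => ENNReal.ofReal (g l * g m)) ^ (1 / 2 : ℝ)

variable {H : Type*} [NormedAddCommGroup H] [InnerProductSpace ℝ H]

/-- `J = ∫ f dY` over the real line, the limit of `∫_A^B f dY` as `A → -∞`, `B → ∞`. -/
def IsStieltjesIntegral (f : ℝ → ℝ) (Y : ℝ → H) (J : H) : Prop :=
  ∃ K : ℝ → ℝ → H, (∀ A B, A ≤ B → IsStieltjesIntegralOn f Y A B (K A B)) ∧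
    Tendsto (fun p : ℝ × ℝ => K p.1 p.2) (atBot ×ˢ atTop) (𝓝 J)

variable {Y : ℝ → H} {f g : ℝ → ℝ} {A B V c M : ℝ} {J J' : H}

lemma variationNorm_lt_top {Γ : ℝ → ℝ → ℝ}
    (hg : variationIntegral Γ (fun l m => ENNReal.ofReal (g l * g m)) < ∞) :
    variationNorm Γ g < ∞ :=
  ENNReal.rpow_lt_top_of_nonneg (by norm_num) hg.ne

lemma variationNorm_one_lt_top {Γ : ℝ → ℝ → ℝ} (hV : VitaliVariationLE Γ V) :
    variationNorm Γ (fun _ => 1) < ∞ :=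
  variationNorm_lt_top <| by
    simpa only [mul_one, ENNReal.ofReal_one] using
      (variationIntegral_one_le hV).trans_lt ENNReal.ofReal_lt_top

lemma eventually_atBot_prod_atTop_le :
    ∀ᶠ p : ℝ × ℝ in atBot ×ˢ atTop, p.1 ≤ p.2 := by
  filter_upwards [(eventually_le_atBot (0 : ℝ)).prod_mk (eventually_ge_atTop (0 : ℝ))] with p hp
  exact hp.1.trans hp.2

lemma IsStieltjesIntegralOn.enorm_le (hJ : IsStieltjesIntegralOn f Y A B J)
    (hV : VitaliVariationLE (gramKernel Y) V) (hf : ContinuousOn f (Icc A B)) (hAB : A ≤ B)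
    (hc : 0 < c) (hfg : ∀ l ∈ Icc A B, |f l| ≤ c * g l) :
    ‖J‖ₑ ≤ ENNReal.ofReal c * variationNorm (gramKernel Y) g := by
  have hsq : ‖J‖ₑ ^ 2 ≤ ENNReal.ofReal (c ^ 2) *
      variationIntegral (gramKernel Y) fun l m => ENNReal.ofReal (g l * g m) := by
    rw [← variationIntegral_const_mul (by simpa using hc.ne') ENNReal.ofReal_ne_top]
    refine hJ.enorm_sq_le hV hf hAB fun l hl m hm => ?_
    rw [← ENNReal.ofReal_mul (sq_nonneg c)]
    refine ENNReal.ofReal_le_ofReal ?_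
    calc |f l| * |f m| ≤ (c * g l) * (c * g m) := by
          gcongr
          exacts [(abs_nonneg _).trans (hfg l hl), hfg l hl, hfg m hm]
      _ = c ^ 2 * (g l * g m) := by ring
  calc ‖J‖ₑ = (‖J‖ₑ ^ 2) ^ (1 / 2 : ℝ) := by
        rw [← ENNReal.rpow_natCast_mul]
        norm_num
    _ ≤ _ := ENNReal.rpow_le_rpow hsq (by norm_num)
    _ = ENNReal.ofReal c * variationNorm (gramKernel Y) g := by
        rw [ENNReal.mul_rpow_of_nonneg _ _ (by norm_num), ENNReal.ofReal_pow hc.le,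
          ← ENNReal.rpow_natCast_mul, variationNorm]
        norm_num

lemma exists_isStieltjesIntegral [CompleteSpace H] (hV : VitaliVariationLE (gramKernel Y) V)
    (hg : Tendsto g (cocompact ℝ) atTop) (hgV : variationNorm (gramKernel Y) g ≠ ∞)
    (hf : Continuous f) (hfM : ∀ l, |f l| ≤ M) : ∃ J, IsStieltjesIntegral f Y J := by
  choose! K hK using fun A B (hAB : A ≤ B) =>
    exists_isStieltjesIntegralOn hV (f := f) hf.continuousOn hAB
  suffices hcauchy : Cauchy (map (fun p : ℝ × ℝ => K p.1 p.2) (atBot ×ˢ atTop)) by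
    obtain ⟨J, hJ⟩ := cauchy_map_iff_exists_tendsto.1 hcauchy
    exact ⟨J, K, hK, hJ⟩
  refine EMetric.cauchy_iff.2 ⟨map_neBot.ne, fun ε hε => ?_⟩
  obtain ⟨c, hc, hcε⟩ := ENNReal.exists_nnreal_pos_mul_lt
    (ENNReal.mul_ne_top (a := 4) ENNReal.ofNat_ne_top hgV) hε.ne'
  replace hc : 0 < (c : ℝ) := hc
  rw [← ENNReal.ofReal_coe_nnreal] at hcε
  obtain ⟨⟨A₀, hA₀⟩, ⟨B₀, hB₀⟩⟩ : (∃ A₀, ∀ l ≤ A₀, |f l| ≤ c * g l) ∧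
      ∃ B₀, ∀ l ≥ B₀, |f l| ≤ c * g l := by
    rw [← eventually_atBot, ← eventually_atTop, ← eventually_sup, ← cocompact_eq_atBot_atTop]
    filter_upwards [hg.eventually_ge_atTop (M / c)] with l hl
    exact (hfM l).trans ((div_le_iff₀' hc).1 hl)
  have htail {A B : ℝ} (hA : A ≤ min A₀ 0) (hB : max B₀ 0 ≤ B) :
      edist (K A B) (K (min A₀ 0) (max B₀ 0)) ≤
        2 * (ENNReal.ofReal c * variationNorm (gramKernel Y) g) := by
    have hmid : min A₀ 0 ≤ max B₀ 0 := (min_le_right _ _).trans (le_max_right _ _)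
    rw [edist_eq_enorm_sub, (hK _ _ (hA.trans (hmid.trans hB))).eq_add hA (hmid.trans hB)
      (hK _ _ hA) (hK _ _ (hmid.trans hB)), (hK _ _ (hmid.trans hB)).eq_add hmid hB (hK _ _ hmid)
      (hK _ _ hB), add_sub_assoc, add_sub_cancel_left, two_mul]
    refine (enorm_add_le _ _).trans (add_le_add ?_ ?_)
    · exact (hK _ _ hA).enorm_le hV hf.continuousOn hA hc fun l hl =>
        hA₀ l (hl.2.trans (min_le_left _ _))
    · exact (hK _ _ hB).enorm_le hV hf.continuousOn hB hc fun l hl =>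
        hB₀ l ((le_max_left _ _).trans hl.1)
  refine ⟨_, image_mem_map (prod_mem_prod (Iic_mem_atBot (min A₀ 0)) (Ici_mem_atTop (max B₀ 0))),
    ?_⟩
  rintro _ ⟨p, hp, rfl⟩ _ ⟨p', hp', rfl⟩
  refine (edist_triangle_right _ _ _).trans_lt ((add_le_add (htail hp.1 hp.2)
    (htail hp'.1 hp'.2)).trans_lt (lt_of_eq_of_lt ?_ hcε))
  ring

namespace IsStieltjesIntegral

lemma sub (hf : IsStieltjesIntegral f Y J) (hg : IsStieltjesIntegral g Y J') :
    IsStieltjesIntegral (fun l => f l - g l) Y (J - J') := by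
  obtain ⟨K, hK, hJ⟩ := hf
  obtain ⟨K', hK', hJ'⟩ := hg
  exact ⟨fun A B => K A B - K' A B, fun A B hAB => (hK A B hAB).sub (hK' A B hAB), hJ.sub hJ'⟩

lemma mem_closure_span (hJ : IsStieltjesIntegral f Y J) :
    J ∈ closure (Submodule.span ℝ (range Y) : Set H) := by
  obtain ⟨K, hK, hJ⟩ := hJ
  refine isClosed_closure.mem_of_tendsto hJ ?_
  filter_upwards [eventually_atBot_prod_atTop_le] with p hp
  exact (hK _ _ hp).mem_closure_span hp

lemma enorm_le (hJ : IsStieltjesIntegral f Y J) (hV : VitaliVariationLE (gramKernel Y) V)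
    (hf : Continuous f) (hc : 0 < c) (hfg : ∀ l, |f l| ≤ c * g l) :
    ‖J‖ₑ ≤ ENNReal.ofReal c * variationNorm (gramKernel Y) g := by
  obtain ⟨K, hK, hJ⟩ := hJ
  refine le_of_tendsto hJ.enorm ?_
  filter_upwards [eventually_atBot_prod_atTop_le] with p hp
  exact (hK _ _ hp).enorm_le hV hf.continuousOn hp hc fun l _ => hfg l

lemma enorm_le_add [CompleteSpace H] (hJ : IsStieltjesIntegral f Y J)
    (hV : VitaliVariationLE (gramKernel Y) V)
    (hg : Continuous g) (hg₀ : ∀ l, 0 ≤ g l) (hg_top : Tendsto g (cocompact ℝ) atTop)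
    (hgV : variationNorm (gramKernel Y) g ≠ ∞) (hf : Continuous f) (hc : 0 < c)
    (hfg : ∀ l, |f l| ≤ c * (1 + g l)) :
    ‖J‖ₑ ≤ ENNReal.ofReal c *
      (variationNorm (gramKernel Y) (fun _ => 1) + variationNorm (gramKernel Y) g) := by
  -- Split `f = F + F * g` with `F = f / (1 + g)`, and bound the parts by `c` and `c * g`.
  have hpos (l) : 0 < 1 + g l := add_pos_of_pos_of_nonneg one_pos (hg₀ l)
  have hcont : Continuous fun l => f l / (1 + g l) :=
    hf.div (continuous_const.add hg) fun l => (hpos l).ne'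
  have hle (l) : |f l / (1 + g l)| ≤ c := by
    rw [abs_div, abs_of_pos (hpos l), div_le_iff₀ (hpos l)]
    exact hfg l
  have hrest (l) : |f l - f l / (1 + g l)| ≤ c * g l := by
    rw [show f l - f l / (1 + g l) = f l / (1 + g l) * g l by field_simp [(hpos l).ne']; ring,
      abs_mul, abs_of_nonneg (hg₀ l)]
    exact mul_le_mul_of_nonneg_right (hle l) (hg₀ l)
  obtain ⟨J₁, hJ₁⟩ := exists_isStieltjesIntegral hV hg_top hgV hcont hle
  rw [← add_sub_cancel J₁ J, mul_add]
  refine (enorm_add_le _ _).trans (add_le_add ?_ ?_)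
  · exact hJ₁.enorm_le hV hcont hc fun l => (hle l).trans_eq (mul_one c).symm
  · exact (hJ.sub hJ₁).enorm_le hV (hf.sub hcont) hc hrest

end IsStieltjesIntegral

end ImproperIntegral

section MeanSquare

variable {Ω : Type*} [MeasurableSpace Ω] {P : Measure Ω} {y : ℝ → Ω → ℝ} {f g : ℝ → ℝ}
  {J J' : Ω → ℝ} {c M : ℝ}

/-- A second-order process as a curve in `L²`. -/
noncomputable def toL2 (hy : ∀ s, MemLp (y s) 2 P) (s : ℝ) : Lp ℝ 2 P :=
  (hy s).toLp (y s)

lemma gramKernel_toL2 (hy : ∀ s, MemLp (y s) 2 P) : gramKernel (toL2 hy) = covFun y P := by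
  funext s t
  rw [gramKernel, covFun, L2.inner_def]
  refine integral_congr_ae ?_
  filter_upwards [(hy s).coeFn_toLp, (hy t).coeFn_toLp] with ω hs ht
  simp only [toL2, hs, ht, RCLike.inner_apply, conj_trivial]
  exact mul_comm _ _

lemma coeFn_sum_smul {ι : Type*} (s : Finset ι) (b : ι → ℝ) {v : ι → Lp ℝ 2 P} {ζ : ι → Ω → ℝ}
    (hv : ∀ i ∈ s, v i =ᵐ[P] ζ i) :
    (∑ i ∈ s, b i • v i : Lp ℝ 2 P) =ᵐ[P] fun ω => ∑ i ∈ s, b i * ζ i ω := by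
  have hterm : ∀ᵐ ω ∂P, ∀ i ∈ s, (b i • v i : Lp ℝ 2 P) ω = b i * ζ i ω := by
    rw [Finset.eventually_all]
    intro i hi
    filter_upwards [Lp.coeFn_smul (b i) (v i), hv i hi] with ω hsmul hω
    rw [hsmul, Pi.smul_apply, smul_eq_mul, hω]
  filter_upwards [hterm, Lp.coeFn_finsetSum s fun i => b i • v i] with ω hω hsum
  rw [hsum, Finset.sum_apply]
  exact Finset.sum_congr rfl hω

lemma coeFn_stieltjesSum (hy : ∀ s, MemLp (y s) 2 P) (f : ℝ → ℝ) {A B : ℝ}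
    (π : TaggedPartition A B) :
    (stieltjesSum f (toL2 hy) π : Lp ℝ 2 P) =ᵐ[P] fun ω =>
      ∑ i ∈ Finset.range π.card, f (π.tag i) * (y (π.point (i + 1)) ω - y (π.point i) ω) :=
  coeFn_sum_smul _ _ fun _ _ =>
    (Lp.coeFn_sub _ _).trans ((hy _).coeFn_toLp.sub (hy _).coeFn_toLp)

lemma eLpNorm_sub_eq_edist {v w : Lp ℝ 2 P} {ζ ζ' : Ω → ℝ} (hv : v =ᵐ[P] ζ) (hw : w =ᵐ[P] ζ') :
    eLpNorm (fun ω => ζ ω - ζ' ω) 2 P = edist v w := by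
  rw [Lp.edist_def]
  exact eLpNorm_congr_ae (hv.sub hw).symm

lemma isMeanSquareIntegralOn_iff (hy : ∀ s, MemLp (y s) 2 P) {A B : ℝ} :
    IsMeanSquareIntegralOn f y A B J P ↔
      ∃ hJ : MemLp J 2 P, IsStieltjesIntegralOn f (toL2 hy) A B (hJ.toLp J) := by
  rw [IsMeanSquareIntegralOn, ← exists_prop]
  refine exists_congr fun hJ => ?_
  rw [IsStieltjesIntegralOn,
    (TaggedPartition.hasBasis_fine A B).tendsto_iff Metric.nhds_basis_closedEBall]
  refine forall₂_congr fun ε _ => exists_congr fun δ => and_congr_right fun _ =>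
    ⟨fun h π hπ => ?_, fun h n s ξ hs hsA hsB hδ hξ => ?_⟩
  · rw [Metric.mem_closedEBall,
      ← eLpNorm_sub_eq_edist (coeFn_stieltjesSum hy f π) hJ.coeFn_toLp]
    exact h _ _ _ π.monotone_point π.point_zero π.point_card hπ π.tag_mem_Icc
  · have hπ := h ⟨n, s, ξ, hs, hsA, hsB, hξ⟩ hδ
    rwa [Metric.mem_closedEBall,
      ← eLpNorm_sub_eq_edist (coeFn_stieltjesSum hy f _) hJ.coeFn_toLp] at hπ

lemma isMeanSquareIntegral_iff (hy : ∀ s, MemLp (y s) 2 P) :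
    IsMeanSquareIntegral f y J P ↔
      ∃ hJ : MemLp J 2 P, IsStieltjesIntegral f (toL2 hy) (hJ.toLp J) := by
  rw [IsMeanSquareIntegral, ← exists_prop]
  refine exists_congr fun hJ => ⟨?_, ?_⟩
  · rintro ⟨K, hK, hlim⟩
    have hK' (A B) (hAB : A ≤ B) :
        ∃ v : Lp ℝ 2 P, v =ᵐ[P] K A B ∧ IsStieltjesIntegralOn f (toL2 hy) A B v := by
      obtain ⟨hmem, hint⟩ := (isMeanSquareIntegralOn_iff hy).1 (hK A B hAB)
      exact ⟨_, hmem.coeFn_toLp, hint⟩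
    choose! v hvK hv using hK'
    refine ⟨v, hv, tendsto_iff_edist_tendsto_0.2 (hlim.congr' ?_)⟩
    filter_upwards [eventually_atBot_prod_atTop_le] with p hp
    exact eLpNorm_sub_eq_edist (hvK _ _ hp) hJ.coeFn_toLp
  · rintro ⟨K, hK, hlim⟩
    refine ⟨fun A B => K A B, fun A B hAB => (isMeanSquareIntegralOn_iff hy).2
      ⟨Lp.memLp _, by rw [Lp.toLp_coeFn]; exact hK A B hAB⟩,
      (tendsto_iff_edist_tendsto_0.1 hlim).congr fun p =>
        (eLpNorm_sub_eq_edist (EventuallyEq.refl _ _) hJ.coeFn_toLp).symm⟩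

lemma exists_isMeanSquareIntegral (hy : ∀ s, MemLp (y s) 2 P)
    (hvar : HasFiniteVitaliVariation (covFun y P)) (hg : Tendsto g (cocompact ℝ) atTop)
    (hgV : variationNorm (covFun y P) g ≠ ∞) (hf : Continuous f) (hfM : ∀ l, |f l| ≤ M) :
    ∃ J, IsMeanSquareIntegral f y J P := by
  rw [← gramKernel_toL2 hy] at hvar hgV
  obtain ⟨V, hV⟩ := hvar
  obtain ⟨J, hJ⟩ := exists_isStieltjesIntegral hV hg hgV hf hfM
  exact ⟨J, (isMeanSquareIntegral_iff hy).2 ⟨Lp.memLp J, by rwa [Lp.toLp_coeFn]⟩⟩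

namespace IsMeanSquareIntegral

lemma congr (hJ : IsMeanSquareIntegral f y J P) (hJJ' : J =ᵐ[P] J') :
    IsMeanSquareIntegral f y J' P := by
  obtain ⟨hmem, K, hK, hlim⟩ := hJ
  exact ⟨hmem.ae_eq hJJ', K, hK, hlim.congr fun p =>
    eLpNorm_congr_ae ((EventuallyEq.refl _ _).sub hJJ')⟩

lemma sub (hy : ∀ s, MemLp (y s) 2 P) (hf : IsMeanSquareIntegral f y J P)
    (hg : IsMeanSquareIntegral g y J' P) :
    IsMeanSquareIntegral (fun l => f l - g l) y (fun ω => J ω - J' ω) P := by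
  obtain ⟨hJ, hfJ⟩ := (isMeanSquareIntegral_iff hy).1 hf
  obtain ⟨hJ', hgJ'⟩ := (isMeanSquareIntegral_iff hy).1 hg
  exact (isMeanSquareIntegral_iff hy).2 ⟨hJ.sub hJ', hfJ.sub hgJ'⟩

lemma eLpNorm_le (hJ : IsMeanSquareIntegral f y J P) (hy : ∀ s, MemLp (y s) 2 P)
    (hvar : HasFiniteVitaliVariation (covFun y P)) (hf : Continuous f) (hc : 0 < c)
    (hfg : ∀ l, |f l| ≤ c * g l) :
    eLpNorm J 2 P ≤ ENNReal.ofReal c * variationNorm (covFun y P) g := by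
  obtain ⟨hmem, hJ⟩ := (isMeanSquareIntegral_iff hy).1 hJ
  rw [← gramKernel_toL2 hy] at hvar ⊢
  obtain ⟨V, hV⟩ := hvar
  rw [← Lp.enorm_toLp hmem]
  exact hJ.enorm_le hV hf hc hfg

lemma eLpNorm_le_add (hJ : IsMeanSquareIntegral f y J P) (hy : ∀ s, MemLp (y s) 2 P)
    (hvar : HasFiniteVitaliVariation (covFun y P)) (hg : Continuous g) (hg₀ : ∀ l, 0 ≤ g l)
    (hg_top : Tendsto g (cocompact ℝ) atTop) (hgV : variationNorm (covFun y P) g ≠ ∞)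
    (hf : Continuous f) (hc : 0 < c) (hfg : ∀ l, |f l| ≤ c * (1 + g l)) :
    eLpNorm J 2 P ≤ ENNReal.ofReal c *
      (variationNorm (covFun y P) (fun _ => 1) + variationNorm (covFun y P) g) := by
  obtain ⟨hmem, hJ⟩ := (isMeanSquareIntegral_iff hy).1 hJ
  rw [← gramKernel_toL2 hy] at hvar hgV ⊢
  obtain ⟨V, hV⟩ := hvar
  rw [← Lp.enorm_toLp hmem]
  exact hJ.enorm_le_add hV hg hg₀ hg_top hgV hf hc hfg

end IsMeanSquareIntegral

end MeanSquare

/-! ### `φ`-sub-Gaussian random variables -/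

section SubGaussian

/-- An Orlicz function without the convexity requirement: continuous, vanishing at `0`, even and
increasing on `[0, ∞)`, the last two encoded as monotonicity in `|x|`. -/
structure IsPreOrlicz (φ : ℝ → ℝ) : Prop where
  map_zero : φ 0 = 0
  continuous : Continuous φ
  le_of_abs_le : ∀ {x y : ℝ}, |x| ≤ |y| → φ x ≤ φ y

lemma isPreOrlicz_powerOrlicz {α : ℝ} (hα : 0 < α) : IsPreOrlicz (powerOrlicz α) where
  map_zero := by rw [powerOrlicz, abs_zero, Real.zero_rpow hα.ne', zero_div]
  continuous := (continuous_abs.rpow_const fun _ => Or.inr hα.le).div_const α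
  le_of_abs_le hxy := by
    unfold powerOrlicz
    gcongr

lemma IsPreOrlicz.nonneg {φ : ℝ → ℝ} (hφ : IsPreOrlicz φ) (x : ℝ) : 0 ≤ φ x :=
  hφ.map_zero.symm.trans_le (hφ.le_of_abs_le (by rw [abs_zero]; exact abs_nonneg x))

lemma IsPreOrlicz.neg {φ : ℝ → ℝ} (hφ : IsPreOrlicz φ) (x : ℝ) : φ (-x) = φ x :=
  (hφ.le_of_abs_le (abs_neg x).le).antisymm (hφ.le_of_abs_le (abs_neg x).ge)

variable {Ω : Type*} [MeasurableSpace Ω] {P : Measure Ω} {φ : ℝ → ℝ} {ζ ζ' : Ω → ℝ} {a a' : ℝ}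

/-- `E exp(l ζ) ≤ exp(φ(a l))` for all `l`, the condition on `a` in the definition of
`τ_φ(ζ)`. -/
def ExpMomentLE (φ : ℝ → ℝ) (a : ℝ) (ζ : Ω → ℝ) (P : Measure Ω) : Prop :=
  ∀ l : ℝ, ∫⁻ ω, ENNReal.ofReal (Real.exp (l * ζ ω)) ∂P ≤ ENNReal.ofReal (Real.exp (φ (a * l)))

lemma aemeasurable_ofReal_exp (hζ : AEMeasurable ζ P) :
    AEMeasurable (fun ω => ENNReal.ofReal (Real.exp (ζ ω))) P :=
  (Real.measurable_exp.comp_aemeasurable hζ).ennreal_ofReal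

lemma continuous_ofReal_exp_comp (hφ : Continuous φ) :
    Continuous fun x => ENNReal.ofReal (Real.exp (φ x)) :=
  ENNReal.continuous_ofReal.comp (Real.continuous_exp.comp hφ)

namespace ExpMomentLE

lemma mono (hζ : ExpMomentLE φ a ζ P) (hφ : IsPreOrlicz φ) (ha : 0 ≤ a) (haa' : a ≤ a') :
    ExpMomentLE φ a' ζ P := fun l => by
  have habs : |a * l| ≤ |a' * l| := by
    rw [abs_mul, abs_mul, abs_of_nonneg ha, abs_of_nonneg (ha.trans haa')]
    gcongr
  exact (hζ l).trans (ENNReal.ofReal_le_ofReal (Real.exp_le_exp.2 (hφ.le_of_abs_le habs)))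

lemma congr (hζ : ExpMomentLE φ a ζ P) (hζζ' : ζ =ᵐ[P] ζ') : ExpMomentLE φ a ζ' P := fun l => by
  refine (lintegral_congr_ae ?_).trans_le (hζ l)
  filter_upwards [hζζ'] with ω hω
  rw [hω]

lemma of_tendsto_ae {ζ : ℕ → Ω → ℝ} {a : ℕ → ℝ} (hφ : Continuous φ)
    (hm : ∀ n, AEMeasurable (ζ n) P) (hζ : ∀ n, ExpMomentLE φ (a n) (ζ n) P)
    (hlim : ∀ᵐ ω ∂P, Tendsto (fun n => ζ n ω) atTop (𝓝 (ζ' ω))) (ha : Tendsto a atTop (𝓝 a')) :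
    ExpMomentLE φ a' ζ' P := fun l =>
  calc ∫⁻ ω, ENNReal.ofReal (Real.exp (l * ζ' ω)) ∂P
      = ∫⁻ ω, liminf (fun n => ENNReal.ofReal (Real.exp (l * ζ n ω))) atTop ∂P := by
        refine lintegral_congr_ae ?_
        filter_upwards [hlim] with ω hω
        exact (((continuous_ofReal_exp_comp (continuous_const_mul l)).tendsto _).comp
          hω).liminf_eq.symm
    _ ≤ liminf (fun n => ∫⁻ ω, ENNReal.ofReal (Real.exp (l * ζ n ω)) ∂P) atTop :=
        lintegral_liminf_le' fun n => aemeasurable_ofReal_exp ((hm n).const_mul l)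
    _ ≤ liminf (fun n => ENNReal.ofReal (Real.exp (φ (a n * l)))) atTop :=
        liminf_le_liminf (Eventually.of_forall fun n => hζ n l)
    _ = ENNReal.ofReal (Real.exp (φ (a' * l))) :=
        (((continuous_ofReal_exp_comp (hφ.comp (continuous_mul_const l))).tendsto _).comp
          ha).liminf_eq

lemma memLp (hζ : ExpMomentLE φ a ζ P) (hm : AEMeasurable ζ P) (p : ℝ≥0) : MemLp ζ p P := by
  refine memLp_of_mem_interior_integrableExpSet ?_ p
  suffices huniv : integrableExpSet ζ P = univ by
    rw [huniv, interior_univ]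
    exact mem_univ 0
  refine eq_univ_of_forall fun l => ?_
  have hmeas : AEStronglyMeasurable (fun ω => Real.exp (l * ζ ω)) P :=
    (Real.measurable_exp.comp_aemeasurable (hm.const_mul l)).aestronglyMeasurable
  exact (lintegral_ofReal_ne_top_iff_integrable hmeas
    (Eventually.of_forall fun ω => (Real.exp_pos _).le)).1
      ((hζ l).trans_lt ENNReal.ofReal_lt_top).ne

lemma lintegral_exp_abs_le (hζ : ExpMomentLE φ a ζ P) (hφ : IsPreOrlicz φ)
    (hm : AEMeasurable ζ P) (l : ℝ) :
    ∫⁻ ω, ENNReal.ofReal (Real.exp (l * |ζ ω|)) ∂P ≤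
      2 * ENNReal.ofReal (Real.exp (φ (a * l))) := by
  have hneg := hζ (-l)
  rw [mul_neg, hφ.neg] at hneg
  calc ∫⁻ ω, ENNReal.ofReal (Real.exp (l * |ζ ω|)) ∂P
      ≤ ∫⁻ ω, (ENNReal.ofReal (Real.exp (l * ζ ω)) + ENNReal.ofReal (Real.exp (-l * ζ ω))) ∂P := by
        refine lintegral_mono fun ω => ?_
        rcases abs_choice (ζ ω) with hω | hω <;> simp only [hω, neg_mul, mul_neg]
        exacts [le_self_add, le_add_self]
    _ ≤ _ := by
        rw [lintegral_add_left' (aemeasurable_ofReal_exp (hm.const_mul l)), two_mul]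
        exact add_le_add (hζ l) hneg

lemma measure_abs_gt_le (hζ : ExpMomentLE φ a ζ P) (hφ : IsPreOrlicz φ) (hm : AEMeasurable ζ P)
    (ha : 0 < a) (r : ℝ) :
    P {ω | r < |ζ ω|} ≤ ENNReal.ofReal (2 * Real.exp (φ 1) * Real.exp (-(r / a))) := by
  have hmom := hζ.lintegral_exp_abs_le hφ hm a⁻¹
  rw [mul_inv_cancel₀ ha.ne'] at hmom
  have hsub : {ω | r < |ζ ω|} ⊆
      {ω | ENNReal.ofReal (Real.exp (r / a)) ≤ ENNReal.ofReal (Real.exp (a⁻¹ * |ζ ω|))} :=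
    fun ω hω => ENNReal.ofReal_le_ofReal <| Real.exp_le_exp.2 <| by
      rw [div_eq_inv_mul]
      exact mul_le_mul_of_nonneg_left (le_of_lt hω) (inv_nonneg.2 ha.le)
  have hexp : ENNReal.ofReal (Real.exp (r / a)) ≠ 0 := (ENNReal.ofReal_pos.2 (Real.exp_pos _)).ne'
  calc P {ω | r < |ζ ω|} ≤ P {ω | ENNReal.ofReal (Real.exp (r / a)) ≤
        ENNReal.ofReal (Real.exp (a⁻¹ * |ζ ω|))} := measure_mono hsub
    _ ≤ (2 * ENNReal.ofReal (Real.exp (φ 1))) / ENNReal.ofReal (Real.exp (r / a)) :=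
        (meas_ge_le_lintegral_div (aemeasurable_ofReal_exp (hm.abs.const_mul a⁻¹)) hexp
          ENNReal.ofReal_ne_top).trans (ENNReal.div_le_div_right hmom _)
    _ = ENNReal.ofReal (2 * Real.exp (φ 1) * Real.exp (-(r / a))) := by
        rw [Real.exp_neg, ← div_eq_mul_inv, ENNReal.ofReal_div_of_pos (Real.exp_pos _),
          ENNReal.ofReal_mul zero_le_two, ENNReal.ofReal_ofNat]

end ExpMomentLE

lemma subGaussianStandard_le_ofReal_iff (hφ : IsPreOrlicz φ) (ha : 0 ≤ a) :
    subGaussianStandard φ ζ P ≤ ENNReal.ofReal a ↔ ExpMomentLE φ a ζ P := by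
  constructor
  · intro hle l
    have hlim := ((continuous_ofReal_exp_comp (hφ.continuous.comp
      (continuous_mul_const l))).tendsto a).mono_left (nhdsWithin_le_nhds (s := Ioi a))
    refine ge_of_tendsto hlim ?_
    filter_upwards [self_mem_nhdsWithin] with a' haa'
    have hlt := hle.trans_lt ((ENNReal.ofReal_lt_ofReal_iff (ha.trans_lt haa')).2 haa')
    simp only [subGaussianStandard, iInf_lt_iff] at hlt
    obtain ⟨b, ⟨hb, hζ⟩, hba'⟩ := hlt
    exact ExpMomentLE.mono hζ hφ hb.le ((ENNReal.ofReal_lt_ofReal_iff_of_nonneg hb.le).1 hba').le l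
  · intro hζ
    refine ENNReal.le_of_forall_pos_le_add fun ε hε _ => ?_
    have hlt : a < a + ε := lt_add_of_pos_right a hε
    refine (iInf₂_le (a + ε) ⟨ha.trans_lt hlt, hζ.mono hφ ha hlt.le⟩).trans ?_
    rw [ENNReal.ofReal_add ha ε.coe_nonneg, ENNReal.ofReal_coe_nnreal]

end SubGaussian

namespace IsStrictlyPhiSubGaussian

variable {Ω : Type*} [MeasurableSpace Ω] {P : Measure Ω} {φ : ℝ → ℝ} {y : ℝ → Ω → ℝ} {C : ℝ≥0}

lemma memLp (hs : IsStrictlyPhiSubGaussian φ y C P) (s : ℝ) : MemLp (y s) 2 P := by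
  obtain ⟨a, -, ha⟩ := (hs.subGaussian s).exp_bound
  exact ExpMomentLE.memLp (fun l => by rw [mul_comm a]; exact ha l)
    (hs.subGaussian s).aemeasurable 2

lemma expMomentLE_of_mem_span (hs : IsStrictlyPhiSubGaussian φ y C P) (hφ : IsPreOrlicz φ)
    (hy : ∀ s, MemLp (y s) 2 P) {v : Lp ℝ 2 P} (hv : v ∈ Submodule.span ℝ (range (toL2 hy))) :
    ExpMomentLE φ (C * ‖v‖) v P := by
  obtain ⟨b, rfl⟩ := Finsupp.mem_span_range_iff_exists_finsupp.1 hv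
  rw [Finsupp.sum]
  have hsum := coeFn_sum_smul b.support b fun u _ => (hy u).coeFn_toLp
  refine ExpMomentLE.congr ?_ hsum.symm
  rw [← subGaussianStandard_le_ofReal_iff hφ (by positivity), ENNReal.ofReal_mul C.coe_nonneg,
    ENNReal.ofReal_coe_nnreal, ofReal_norm, Lp.enorm_def]
  exact (hs.standard_le b.support b).trans_eq (by rw [eLpNorm_congr_ae hsum.symm]; rfl)

lemma expMomentLE_of_mem_closure (hs : IsStrictlyPhiSubGaussian φ y C P) (hφ : IsPreOrlicz φ)
    (hy : ∀ s, MemLp (y s) 2 P) {v : Lp ℝ 2 P}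
    (hv : v ∈ closure (Submodule.span ℝ (range (toL2 hy)) : Set (Lp ℝ 2 P))) :
    ExpMomentLE φ (C * ‖v‖) v P := by
  obtain ⟨w, hw, hlim⟩ := mem_closure_iff_seq_limit.1 hv
  obtain ⟨ns, hns, hae⟩ := (tendstoInMeasure_of_tendsto_Lp hlim).exists_seq_tendsto_ae
  exact ExpMomentLE.of_tendsto_ae (ζ := fun n => w (ns n)) hφ.continuous
    (fun n => (Lp.aestronglyMeasurable _).aemeasurable)
    (fun n => hs.expMomentLE_of_mem_span hφ hy (hw (ns n))) hae
    ((hlim.comp hns.tendsto_atTop).norm.const_mul _)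

lemma subGaussianStandard_le (hs : IsStrictlyPhiSubGaussian φ y C P) (hφ : IsPreOrlicz φ)
    {f : ℝ → ℝ} {J : Ω → ℝ} (hJ : IsMeanSquareIntegral f y J P) :
    subGaussianStandard φ J P ≤ C * eLpNorm J 2 P := by
  obtain ⟨hmem, hJ⟩ := (isMeanSquareIntegral_iff hs.memLp).1 hJ
  rw [← Lp.enorm_toLp hmem, ← ofReal_norm, ← ENNReal.ofReal_coe_nnreal,
    ← ENNReal.ofReal_mul C.coe_nonneg, subGaussianStandard_le_ofReal_iff hφ (by positivity)]
  exact (hs.expMomentLE_of_mem_closure hφ hs.memLp hJ.mem_closure_span).congr hmem.coeFn_toLp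

end IsStrictlyPhiSubGaussian

section Gaussian

variable {Ω : Type*} [MeasurableSpace Ω] {P : Measure Ω} {ζ : Ω → ℝ}

lemma expMomentLE_of_hasGaussianLaw (hζ : HasGaussianLaw ζ P) (h0 : ∫ ω, ζ ω ∂P = 0) :
    ExpMomentLE (powerOrlicz 2) √Var[ζ; P] ζ P := by
  intro l
  have hmgf : mgf ζ P l = Real.exp (Var[ζ; P] * l ^ 2 / 2) := by
    rw [mgf_gaussianReal hζ.map_eq_gaussianReal, h0, zero_mul, zero_add,
      Real.coe_toNNReal _ (variance_nonneg _ _)]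
  have hint : Integrable (fun ω => Real.exp (l * ζ ω)) P := by
    by_contra hint
    exact (Real.exp_pos _).ne ((mgf_undef hint).symm.trans hmgf)
  rw [← ofReal_integral_eq_lintegral_ofReal hint (.of_forall fun _ => (Real.exp_pos _).le)]
  refine (congrArg ENNReal.ofReal (hmgf.trans ?_)).le
  rw [powerOrlicz, Real.rpow_two, sq_abs, mul_pow, Real.sq_sqrt (variance_nonneg _ _)]

lemma eLpNorm_two_eq_ofReal_sqrt_variance (hζ : MemLp ζ 2 P) (h0 : ∫ ω, ζ ω ∂P = 0) :
    eLpNorm ζ 2 P = ENNReal.ofReal √Var[ζ; P] := by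
  rw [variance_of_integral_eq_zero hζ.aestronglyMeasurable.aemeasurable h0, Real.sqrt_eq_rpow,
    hζ.eLpNorm_eq_integral_rpow_norm two_ne_zero ENNReal.ofNat_ne_top]
  simp only [ENNReal.toReal_ofNat, Real.rpow_two, Real.norm_eq_abs, sq_abs, one_div]

lemma subGaussianStandard_le_eLpNorm_of_hasGaussianLaw (hζ : HasGaussianLaw ζ P)
    (h0 : ∫ ω, ζ ω ∂P = 0) : subGaussianStandard (powerOrlicz 2) ζ P ≤ eLpNorm ζ 2 P := by
  rw [eLpNorm_two_eq_ofReal_sqrt_variance hζ.memLp_two h0,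
    subGaussianStandard_le_ofReal_iff (isPreOrlicz_powerOrlicz two_pos) (Real.sqrt_nonneg _)]
  exact expMomentLE_of_hasGaussianLaw hζ h0

lemma isStrictlyPhiSubGaussian_of_isGaussianProcess {y : ℝ → Ω → ℝ} (hy : IsGaussianProcess y P)
    (h0 : ∀ s, ∫ ω, y s ω ∂P = 0) : IsStrictlyPhiSubGaussian (powerOrlicz 2) y 1 P where
  subGaussian u := by
    refine ⟨hy.aemeasurable u, h0 u, max √Var[y u; P] 1, lt_max_of_lt_right one_pos, fun l => ?_⟩
    rw [mul_comm l]
    exact (expMomentLE_of_hasGaussianLaw (hy.hasGaussianLaw_eval u) (h0 u)).mono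
      (isPreOrlicz_powerOrlicz two_pos) (Real.sqrt_nonneg _) (le_max_left _ _) l
  standard_le s c := by
    rw [ENNReal.coe_one, one_mul]
    refine subGaussianStandard_le_eLpNorm_of_hasGaussianLaw (hy.smul c).hasGaussianLaw_fun_sum ?_
    rw [integral_finsetSum _ fun u _ => (hy.hasGaussianLaw_eval u).integrable.const_mul _]
    exact Finset.sum_eq_zero fun u _ => by rw [integral_const_mul, h0, mul_zero]

end Gaussian

/-! ### Nets and continuous modifications -/

section Nets

variable {E E' : Type*} [PseudoMetricSpace E] [PseudoMetricSpace E']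

/-- `V` is a finite `h`-net of `D` consisting of points of `D`. -/
structure IsNet (V : Finset E) (h : ℝ) (D : Set E) : Prop where
  mem : ∀ p ∈ V, p ∈ D
  exists_dist_le : ∀ p ∈ D, ∃ q ∈ V, dist p q ≤ h

/-- `D` has metric entropy of polynomial order `m` at the scale `L`: it has `h`-nets of at most
`(L / h) ^ m` points. The radii are at most `L / 2`, so that the `⌊L / (2 h)⌋ + 1 ≤ L / h` points
needed for an interval of length `L` are allowed with `m = 1`. -/
def HasPolynomialNets (D : Set E) (L : ℝ) (m : ℕ) : Prop :=
  ∀ h : ℝ, 0 < h → h ≤ L / 2 → ∃ V : Finset E, IsNet V h D ∧ (V.card : ℝ) ≤ (L / h) ^ m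

lemma hasPolynomialNets_Icc {a b L : ℝ} (hab : a ≤ b) (hL : b - a ≤ L) :
    HasPolynomialNets (Icc a b) L 1 := by
  intro h hh hhL
  have h2 : 0 < 2 * h := by positivity
  refine ⟨(Finset.range (⌊(b - a) / (2 * h)⌋₊ + 1)).image fun i : ℕ =>
    min (a + (2 * i + 1) * h) b, ⟨fun p hp => ?_, fun p hp => ?_⟩, ?_⟩
  · obtain ⟨i, -, rfl⟩ := Finset.mem_image.1 hp
    exact ⟨le_min (le_add_of_nonneg_right (by positivity)) hab, min_le_right _ _⟩
  · have hpa : 0 ≤ p - a := sub_nonneg.2 hp.1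
    have hfloor : ⌊(p - a) / (2 * h)⌋₊ ≤ ⌊(b - a) / (2 * h)⌋₊ := by
      have := hp.2
      gcongr
    refine ⟨_, Finset.mem_image_of_mem _ (Finset.mem_range.2 (Nat.lt_succ_of_le hfloor)), ?_⟩
    have hle := (le_div_iff₀ h2).1 (Nat.floor_le (div_nonneg hpa h2.le))
    have hlt := (div_lt_iff₀ h2).1 (Nat.lt_floor_add_one ((p - a) / (2 * h)))
    rw [Real.dist_eq, abs_le]
    rcases min_cases (a + (2 * (⌊(p - a) / (2 * h)⌋₊ : ℝ) + 1) * h) b with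
      ⟨hmin, -⟩ | ⟨hmin, hb⟩ <;>
      rw [hmin] <;> constructor <;> linarith [hp.2]
  · calc _ ≤ ((⌊(b - a) / (2 * h)⌋₊ + 1 : ℕ) : ℝ) := by
          exact_mod_cast Finset.card_image_le.trans_eq (Finset.card_range _)
      _ ≤ L / (2 * h) + 1 := by
          push_cast
          gcongr
          exact (Nat.floor_le (div_nonneg (sub_nonneg.2 hab) h2.le)).trans (by gcongr)
      _ ≤ L / h := by
          rw [div_add_one h2.ne', div_le_div_iff₀ h2 hh]
          nlinarith
      _ = (L / h) ^ 1 := (pow_one _).symm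

lemma HasPolynomialNets.prod {D : Set E} {D' : Set E'} {L : ℝ} {m m' : ℕ}
    (hD : HasPolynomialNets D L m) (hD' : HasPolynomialNets D' L m') :
    HasPolynomialNets (D ×ˢ D') L (m + m') := by
  intro h hh hhL
  obtain ⟨V, hV, hcard⟩ := hD h hh hhL
  obtain ⟨V', hV', hcard'⟩ := hD' h hh hhL
  refine ⟨V ×ˢ V', ⟨fun p hp => ?_, fun p hp => ?_⟩, ?_⟩
  · exact ⟨hV.mem _ (Finset.mem_product.1 hp).1, hV'.mem _ (Finset.mem_product.1 hp).2⟩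
  · obtain ⟨q, hq, hpq⟩ := hV.exists_dist_le p.1 hp.1
    obtain ⟨q', hq', hpq'⟩ := hV'.exists_dist_le p.2 hp.2
    exact ⟨(q, q'), Finset.mk_mem_product hq hq', max_le hpq hpq'⟩
  · rw [Finset.card_product, Nat.cast_mul, pow_add]
    exact mul_le_mul hcard hcard' (Nat.cast_nonneg _) ((Nat.cast_nonneg _).trans hcard)

lemma hasPolynomialNets_Icc_prod_Icc {a b c d L : ℝ} (hab : a ≤ b) (hcd : c ≤ d)
    (hL : max (b - a) (d - c) ≤ L) : HasPolynomialNets (Icc a b ×ˢ Icc c d) L 2 :=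
  (hasPolynomialNets_Icc hab ((le_max_left _ _).trans hL)).prod
    (hasPolynomialNets_Icc hcd ((le_max_right _ _).trans hL))

/-- The average of `x` over the points of `V` at distance less than `2 h` from `p`, with weights
`2 h - dist p q`: it interpolates the values of `x` on an `h`-net `V` continuously. -/
noncomputable def netAverage (V : Finset E) (h : ℝ) (x : E → ℝ) (p : E) : ℝ :=
  (∑ q ∈ V, max 0 (2 * h - dist p q) * x q) / ∑ q ∈ V, max 0 (2 * h - dist p q)

variable {D : Set E} {V V' : Finset E} {h h' r z : ℝ} {p : E} {x : E → ℝ}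

namespace IsNet

lemma sum_netAverage_weight_pos (hV : IsNet V h D) (hh : 0 < h) (hp : p ∈ D) :
    0 < ∑ q ∈ V, max 0 (2 * h - dist p q) := by
  obtain ⟨q, hq, hpq⟩ := hV.exists_dist_le p hp
  exact Finset.sum_pos' (fun _ _ => le_max_left _ _) ⟨q, hq, lt_max_of_lt_right (by linarith)⟩

lemma abs_netAverage_sub_le (hV : IsNet V h D) (hh : 0 < h) (hp : p ∈ D)
    (hx : ∀ q ∈ V, dist p q < 2 * h → |x q - z| ≤ r) : |netAverage V h x p - z| ≤ r := by
  have hpos := hV.sum_netAverage_weight_pos hh hp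
  have hsub : netAverage V h x p - z = (∑ q ∈ V, max 0 (2 * h - dist p q) * (x q - z)) /
      ∑ q ∈ V, max 0 (2 * h - dist p q) := by
    simp only [netAverage, mul_sub, Finset.sum_sub_distrib, ← Finset.sum_mul]
    field_simp
  rw [hsub, abs_div, abs_of_pos hpos, div_le_iff₀ hpos, Finset.mul_sum]
  refine (Finset.abs_sum_le_sum_abs _ _).trans (Finset.sum_le_sum fun q hq => ?_)
  rw [abs_mul, abs_of_nonneg (le_max_left _ _), mul_comm]
  rcases lt_or_ge (dist p q) (2 * h) with hlt | hge
  · exact mul_le_mul_of_nonneg_right (hx q hq hlt) (le_max_left _ _)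
  · rw [max_eq_left (by linarith), mul_zero, mul_zero]

lemma abs_netAverage_sub_netAverage_le (hV : IsNet V h D) (hV' : IsNet V' h' D) (hh : 0 < h)
    (hh' : 0 < h') (hp : p ∈ D)
    (hx : ∀ q ∈ V, ∀ q' ∈ V', dist q q' < 2 * h + 2 * h' → |x q - x q'| ≤ r) :
    |netAverage V h x p - netAverage V' h' x p| ≤ r := by
  rw [abs_sub_comm]
  refine hV'.abs_netAverage_sub_le hh' hp fun q' hq' hpq' => ?_
  rw [abs_sub_comm]
  refine hV.abs_netAverage_sub_le hh hp fun q hq hpq => hx q hq q' hq' ?_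
  linarith [dist_triangle_left q q' p]

lemma continuousOn_netAverage (hV : IsNet V h D) (hh : 0 < h) (x : E → ℝ) :
    ContinuousOn (netAverage V h x) D :=
  ContinuousOn.div (by fun_prop) (by fun_prop) fun p hp =>
    (hV.sum_netAverage_weight_pos hh hp).ne'

end IsNet

end Nets

section Modification

variable {Ω E ι : Type*} [MeasurableSpace Ω] {P : Measure Ω} {φ : ℝ → ℝ}

lemma ae_eventually_forall_abs_le (hφ : IsPreOrlicz φ) {ζ : ι → Ω → ℝ}
    (hm : ∀ i, AEMeasurable (ζ i) P) {S : ℕ → Finset ι} {C M : ℝ} (hM : 0 < M)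
    (hcard : ∀ k, ((S k).card : ℝ) ≤ C * M ^ k) {b : ℕ → ℝ} (hb : ∀ k, 0 < b k)
    (hS : ∀ k, ∀ i ∈ S k, ExpMomentLE φ (b k) (ζ i) P) :
    ∀ᵐ ω ∂P, ∀ᶠ k in atTop, ∀ i ∈ S k, |ζ i ω| ≤ Real.log (2 * M) * (k * b k) := by
  set r : ℕ → ℝ := fun k => Real.log (2 * M) * (k * b k) with hr
  set A : ℝ := 2 * Real.exp (φ 1)
  have htail : ∀ k, ∀ i ∈ S k, P {ω | r k < |ζ i ω|} ≤ ENNReal.ofReal (A * ((2 * M) ^ k)⁻¹) := by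
    intro k i hi
    refine ((hS k i hi).measure_abs_gt_le hφ (hm i) (hb k) (r k)).trans_eq ?_
    have hrk : r k / b k = k * Real.log (2 * M) := by
      have := (hb k).ne'
      simp only [hr]
      field_simp
    rw [hrk, Real.exp_neg, Real.exp_nat_mul, Real.exp_log (by positivity)]
  have hunion : ∀ k, P (⋃ i ∈ S k, {ω | r k < |ζ i ω|}) ≤
      ENNReal.ofReal (C * A * (1 / 2) ^ k) := fun k => by
    refine (measure_biUnion_finset_le _ _).trans ((Finset.sum_le_sum (htail k)).trans ?_)
    rw [Finset.sum_const, nsmul_eq_mul, ← ENNReal.ofReal_natCast,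
      ← ENNReal.ofReal_mul (Nat.cast_nonneg _)]
    refine ENNReal.ofReal_le_ofReal ((mul_le_mul_of_nonneg_right (hcard k)
      (by positivity)).trans_eq ?_)
    rw [mul_pow, one_div, inv_pow]
    field_simp
  have hsum : ∑' k, P (⋃ i ∈ S k, {ω | r k < |ζ i ω|}) ≠ ∞ :=
    ((ENNReal.tsum_le_tsum hunion).trans_lt
      (summable_geometric_two.mul_left (C * A)).tsum_ofReal_lt_top).ne
  filter_upwards [ae_eventually_notMem hsum] with ω hω
  filter_upwards [hω] with k hk i hi
  by_contra hlt
  exact hk (mem_biUnion hi (not_le.1 hlt))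

variable [PseudoMetricSpace E] {X : E → Ω → ℝ} {D : Set E} {K L ρ : ℝ} {m : ℕ}

/-- The field `X` is Hölder continuous on `D` in the `φ`-sub-Gaussian standard:
`τ_φ(X p - X q) ≤ K h ^ ρ` whenever `dist p q ≤ h`. -/
def SubGaussianHolderOn (φ : ℝ → ℝ) (X : E → Ω → ℝ) (K ρ : ℝ) (D : Set E) (P : Measure Ω) : Prop :=
  ∀ p ∈ D, ∀ q ∈ D, ∀ h : ℝ, 0 < h → dist p q ≤ h →
    ExpMomentLE φ (K * h ^ ρ) (fun ω => X p ω - X q ω) P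

lemma subGaussianHolderOn_iff (hφ : IsPreOrlicz φ) {C : ℝ≥0} :
    SubGaussianHolderOn φ X C ρ D P ↔ ∀ p ∈ D, ∀ q ∈ D, ∀ h : ℝ, 0 < h → dist p q ≤ h →
      subGaussianStandard φ (fun ω => X p ω - X q ω) P ≤ C * ENNReal.ofReal (h ^ ρ) := by
  refine forall₄_congr fun p _ q _ => forall₃_congr fun h hh _ => ?_
  rw [← subGaussianStandard_le_ofReal_iff hφ (by positivity), ENNReal.ofReal_mul C.coe_nonneg,
    ENNReal.ofReal_coe_nnreal]

namespace SubGaussianHolderOn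

lemma exists_summable_ae_eventually_abs_sub_le (hX : SubGaussianHolderOn φ X K ρ D P)
    (hφ : IsPreOrlicz φ) (hm : ∀ p, AEMeasurable (X p) P) (hK : 0 < K) (hρ : 0 < ρ)
    {S : ℕ → Finset (E × E)} {C M c : ℝ} (hM : 0 < M) (hc : 0 < c)
    (hcard : ∀ k, ((S k).card : ℝ) ≤ C * M ^ k)
    (hS : ∀ k, ∀ z ∈ S k, z.1 ∈ D ∧ z.2 ∈ D ∧ dist z.1 z.2 ≤ c / 2 ^ k) :
    ∃ r : ℕ → ℝ, Summable r ∧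
      ∀ᵐ ω ∂P, ∀ᶠ k in atTop, ∀ z ∈ S k, |X z.1 ω - X z.2 ω| ≤ r k := by
  have hpow : ∀ k : ℕ, K * (c / 2 ^ k) ^ ρ = K * c ^ ρ * (2 ^ (-ρ)) ^ k := fun k => by
    rw [Real.div_rpow hc.le (by positivity), Real.rpow_neg zero_le_two, inv_pow,
      ← Real.rpow_natCast_mul zero_le_two, mul_comm (k : ℝ), Real.rpow_mul_natCast zero_le_two]
    ring
  have hlt : ‖(2 : ℝ) ^ (-ρ)‖ < 1 := by
    rw [Real.norm_of_nonneg (by positivity)]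
    exact Real.rpow_lt_one_of_one_lt_of_neg one_lt_two (neg_lt_zero.2 hρ)
  refine ⟨fun k => Real.log (2 * M) * (k * (K * (c / 2 ^ k) ^ ρ)), ?_,
    ae_eventually_forall_abs_le hφ (fun z : E × E => (hm z.1).sub (hm z.2)) hM hcard
      (fun k => by positivity) fun k z hz => ?_⟩
  · simp only [hpow, mul_left_comm _ (K * c ^ ρ)]
    refine Summable.mul_left _ (Summable.mul_left _ ?_)
    simpa only [pow_one] using summable_pow_mul_geometric_of_norm_lt_one 1 hlt
  · obtain ⟨hz₁, hz₂, hdist⟩ := hS k z hz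
    exact hX _ hz₁ _ hz₂ _ (by positivity) hdist

lemma exists_summable_ae_eventually_abs_netAverage_sub_le (hX : SubGaussianHolderOn φ X K ρ D P)
    (hφ : IsPreOrlicz φ) (hm : ∀ p, AEMeasurable (X p) P) (hK : 0 < K) (hρ : 0 < ρ) (hL : 0 < L)
    {V : ℕ → Finset E} (hV : ∀ k, IsNet (V k) (L / 2 ^ (k + 1)) D)
    (hcard : ∀ k, ((V k).card : ℝ) ≤ (2 ^ (k + 1)) ^ m) :
    ∃ r : ℕ → ℝ, Summable r ∧ ∀ᵐ ω ∂P, ∀ᶠ k in atTop, ∀ p ∈ D,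
      |netAverage (V (k + 1)) (L / 2 ^ (k + 1 + 1)) (fun q => X q ω) p -
        netAverage (V k) (L / 2 ^ (k + 1)) (fun q => X q ω) p| ≤ r k := by
  classical
  have hhalf : ∀ k : ℕ, L / 2 ^ (k + 1 + 1) = L / 2 ^ (k + 1) / 2 := fun k => by
    rw [pow_succ, div_mul_eq_div_div]
  have hcard_prod : ∀ k, ((((V (k + 1)) ×ˢ (V k)).filter
      fun z => dist z.1 z.2 ≤ 2 * L / 2 ^ k).card : ℝ) ≤ 8 ^ m * (4 ^ m) ^ k := fun k =>
    calc _ ≤ ((V (k + 1)).card : ℝ) * (V k).card := by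
          exact_mod_cast (Finset.card_filter_le _ _).trans_eq (Finset.card_product _ _)
      _ ≤ (2 ^ (k + 1 + 1)) ^ m * (2 ^ (k + 1)) ^ m := by
          gcongr
          exacts [hcard (k + 1), hcard k]
      _ = (8 * (2 * 2) ^ k) ^ m := by
          rw [← mul_pow, mul_pow 2 2]
          ring
      _ = 8 ^ m * (4 ^ m) ^ k := by rw [mul_pow, pow_right_comm, two_mul, two_add_two_eq_four]
  obtain ⟨r, hr, hae⟩ := hX.exists_summable_ae_eventually_abs_sub_le hφ hm hK hρ
    (M := 4 ^ m) (c := 2 * L) (by positivity) (by positivity) hcard_prod fun k z hz => by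
      obtain ⟨hz, hdist⟩ := Finset.mem_filter.1 hz
      obtain ⟨hz₁, hz₂⟩ := Finset.mem_product.1 hz
      exact ⟨(hV (k + 1)).mem _ hz₁, (hV k).mem _ hz₂, hdist⟩
  refine ⟨r, hr, ?_⟩
  filter_upwards [hae] with ω hω
  filter_upwards [hω] with k hk p hp
  refine (hV (k + 1)).abs_netAverage_sub_netAverage_le (hV k) (by positivity) (by positivity) hp
    fun q hq q' hq' hlt => hk (q, q')
      (Finset.mem_filter.2 ⟨Finset.mk_mem_product hq hq', hlt.le.trans ?_⟩)
  have hpos : 0 < L / 2 ^ k := by positivity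
  rw [hhalf, pow_succ, div_mul_eq_div_div, mul_div_assoc]
  linarith

lemma ae_tendsto_netAverage (hX : SubGaussianHolderOn φ X K ρ D P)
    (hφ : IsPreOrlicz φ) (hm : ∀ p, AEMeasurable (X p) P) (hK : 0 < K) (hρ : 0 < ρ) (hL : 0 < L)
    {V : ℕ → Finset E} (hV : ∀ k, IsNet (V k) (L / 2 ^ (k + 1)) D)
    (hcard : ∀ k, ((V k).card : ℝ) ≤ (2 ^ (k + 1)) ^ m) {p : E} (hp : p ∈ D) :
    ∀ᵐ ω ∂P, Tendsto (fun k => netAverage (V k) (L / 2 ^ (k + 1)) (fun q => X q ω) p) atTop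
      (𝓝 (X p ω)) := by
  classical
  have hcard_prod : ∀ k, (((V k ×ˢ {p}).filter
      fun z => dist z.1 z.2 ≤ L / 2 ^ k).card : ℝ) ≤ 2 ^ m * (2 ^ m) ^ k := fun k =>
    calc _ ≤ ((V k).card : ℝ) := by
          exact_mod_cast (Finset.card_filter_le _ _).trans_eq
            (by rw [Finset.card_product, Finset.card_singleton, mul_one])
      _ ≤ (2 ^ (k + 1)) ^ m := hcard k
      _ = 2 ^ m * (2 ^ m) ^ k := by ring
  obtain ⟨r, hr, hae⟩ := hX.exists_summable_ae_eventually_abs_sub_le hφ hm hK hρ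
    (M := 2 ^ m) (by positivity) hL hcard_prod fun k z hz => by
      obtain ⟨hz, hdist⟩ := Finset.mem_filter.1 hz
      obtain ⟨hz₁, hz₂⟩ := Finset.mem_product.1 hz
      exact ⟨(hV k).mem _ hz₁, Finset.mem_singleton.1 hz₂ ▸ hp, hdist⟩
  filter_upwards [hae] with ω hω
  rw [tendsto_iff_dist_tendsto_zero]
  refine squeeze_zero' (Eventually.of_forall fun k => dist_nonneg) ?_ hr.tendsto_atTop_zero
  filter_upwards [hω] with k hk
  refine (hV k).abs_netAverage_sub_le (by positivity) hp fun q hq hlt => hk (q, p)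
    (Finset.mem_filter.2 ⟨Finset.mk_mem_product hq (Finset.mem_singleton_self p), ?_⟩)
  rw [dist_comm]
  refine hlt.le.trans_eq ?_
  rw [pow_succ]
  field_simp

theorem exists_continuous_modification (hX : SubGaussianHolderOn φ X K ρ D P)
    (hφ : IsPreOrlicz φ) (hm : ∀ p, AEMeasurable (X p) P) (hK : 0 < K) (hρ : 0 < ρ) (hL : 0 < L)
    (hD : HasPolynomialNets D L m) :
    ∃ U : E → Ω → ℝ, (∀ p ∈ D, X p =ᵐ[P] U p) ∧
      ∀ᵐ ω ∂P, ContinuousOn (fun p => U p ω) D := by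
  have hpos : ∀ k : ℕ, 0 < L / 2 ^ (k + 1) := fun k => by positivity
  have hnets : ∀ k : ℕ, ∃ V : Finset E, IsNet V (L / 2 ^ (k + 1)) D ∧
      (V.card : ℝ) ≤ (2 ^ (k + 1)) ^ m := fun k => by
    have hle : L / 2 ^ (k + 1) ≤ L / 2 :=
      div_le_div_of_nonneg_left hL.le two_pos (le_self_pow₀ one_le_two k.succ_ne_zero)
    obtain ⟨V, hV, hcard⟩ := hD _ (hpos k) hle
    exact ⟨V, hV, hcard.trans_eq (by rw [div_div_cancel₀ hL.ne'])⟩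
  choose V hV hcard using hnets
  set A : ℕ → E → Ω → ℝ := fun k p ω => netAverage (V k) (L / 2 ^ (k + 1)) (fun q => X q ω) p
  obtain ⟨r, hr, hstep⟩ :=
    hX.exists_summable_ae_eventually_abs_netAverage_sub_le hφ hm hK hρ hL hV hcard
  have hunif : ∀ᵐ ω ∂P, TendstoUniformlyOn
      (fun n p => ∑ k ∈ Finset.range n, (A (k + 1) p ω - A k p ω))
      (fun p => ∑' k, (A (k + 1) p ω - A k p ω)) atTop D := by
    filter_upwards [hstep] with ω hω
    exact tendstoUniformlyOn_tsum_nat_eventually hr hω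
  refine ⟨fun p ω => A 0 p ω + ∑' k, (A (k + 1) p ω - A k p ω), fun p hp => ?_, ?_⟩
  · filter_upwards [hunif, hX.ae_tendsto_netAverage hφ hm hK hρ hL hV hcard hp] with ω hω hlim
    have htele := hω.tendsto_at hp
    simp only [Finset.sum_range_sub (fun k => A k p ω)] at htele
    rw [tendsto_nhds_unique htele (hlim.sub_const (A 0 p ω)), add_sub_cancel]
  · filter_upwards [hunif] with ω hω
    have hcont : ∀ k, ContinuousOn (fun p => A k p ω) D := fun k =>
      (hV k).continuousOn_netAverage (hpos k) _
    exact (hcont 0).add (hω.continuousOn (Frequently.of_forall fun n =>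
      continuousOn_finsetSum _ fun k _ => (hcont (k + 1)).sub (hcont k)))

end SubGaussianHolderOn

end Modification

/-! ### Chaining -/

lemma lintegral_prod_rpow_le_of_sum_le_one {Ω ι : Type*} [MeasurableSpace Ω] {P : Measure Ω}
    [IsProbabilityMeasure P] {s : Finset ι} {f : ι → Ω → ℝ≥0∞}
    (hf : ∀ i ∈ s, AEMeasurable (f i) P) {w : ι → ℝ} (hw : ∀ i ∈ s, 0 ≤ w i)
    (hw_sum : ∑ i ∈ s, w i ≤ 1) :
    ∫⁻ ω, ∏ i ∈ s, f i ω ^ w i ∂P ≤ ∏ i ∈ s, (∫⁻ ω, f i ω ∂P) ^ w i := by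
  simpa only [ENNReal.one_rpow, one_mul, lintegral_const, measure_univ] using
    ENNReal.lintegral_mul_prod_norm_pow_le s (g := fun _ => 1) aemeasurable_const hf
      (1 - ∑ i ∈ s, w i) (sub_add_cancel _ _) (sub_nonneg.2 hw_sum) hw

lemma measure_setOf_eventually_le {Ω : Type*} [MeasurableSpace Ω] {P : Measure Ω} {s : ℕ → Set Ω}
    {c : ℝ≥0∞} (hs : ∀ n, P (s n) ≤ c) : P {ω | ∀ᶠ n in atTop, ω ∈ s n} ≤ c := by
  have hunion : {ω | ∀ᶠ n in atTop, ω ∈ s n} = ⋃ N, ⋂ n ≥ N, s n := by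
    ext ω
    simp only [eventually_atTop, mem_iUnion, mem_iInter]
    rfl
  rw [hunion, Monotone.measure_iUnion]
  · exact iSup_le fun N => (measure_mono (biInter_subset_of_mem (le_refl N))).trans (hs N)
  · exact fun N M hNM => biInter_subset_biInter_left fun n (hn : M ≤ n) => hNM.trans hn

section GeometricWeights

variable {θ : ℝ}

lemma sum_geometric_weight_le_one (hθ0 : 0 ≤ θ) (n : ℕ) :
    ∑ k ∈ Finset.range n, (1 - θ) * θ ^ k ≤ 1 := by
  rw [← Finset.mul_sum, mul_neg_geom_sum]
  linarith [pow_nonneg hθ0 n]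

lemma sum_geometric_weight_mul_log_le (hθ0 : 0 < θ) (hθ1 : θ < 1) {x β : ℝ} (hx : 0 ≤ x)
    (hβ : 0 ≤ β) (n : ℕ) :
    ∑ k ∈ Finset.range n, (1 - θ) * θ ^ k * (x + β * (k * -Real.log θ)) ≤ x + β := by
  have h1θ : 0 < 1 - θ := sub_pos.2 hθ1
  have hθ_norm : ‖θ‖ < 1 := by rwa [Real.norm_of_nonneg hθ0.le]
  have hsum : ∑ k ∈ Finset.range n, (k : ℝ) * θ ^ k ≤ θ / (1 - θ) ^ 2 := by
    rw [← tsum_coe_mul_geometric_of_norm_lt_one hθ_norm]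
    refine Summable.sum_le_tsum _ (fun k _ => by positivity) ?_
    simpa only [pow_one] using summable_pow_mul_geometric_of_norm_lt_one 1 hθ_norm
  have hlog : -Real.log θ ≤ (1 - θ) / θ := by
    rw [← Real.log_inv, sub_div, div_self hθ0.ne', one_div]
    exact Real.log_le_sub_one_of_pos (inv_pos.2 hθ0)
  have : 0 ≤ -Real.log θ := neg_nonneg.2 (Real.log_nonpos hθ0.le hθ1.le)
  calc ∑ k ∈ Finset.range n, (1 - θ) * θ ^ k * (x + β * (k * -Real.log θ))
      = x * ∑ k ∈ Finset.range n, (1 - θ) * θ ^ k +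
        β * (-Real.log θ * ((1 - θ) * ∑ k ∈ Finset.range n, (k : ℝ) * θ ^ k)) := by
        simp only [Finset.mul_sum, ← Finset.sum_add_distrib]
        exact Finset.sum_congr rfl fun k _ => by ring
    _ ≤ x * 1 + β * ((1 - θ) / θ * ((1 - θ) * (θ / (1 - θ) ^ 2))) := by
        gcongr
        exact sum_geometric_weight_le_one hθ0.le n
    _ = x + β := by field_simp

end GeometricWeights

section Chain

variable {Ω T : Type*} {X : T → Ω → ℝ} {V : ℕ → Finset T} {π : ℕ → T → T} {θ s : ℝ}

/-- The increments along the chain `q, π k q, π (k - 1) (π k q), …` ending in `V 0`: the `k`-th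
one is attached to a point `q` of `V k`, and for `k = 0` it is the value of the field itself. -/
def chainIncrement (X : T → Ω → ℝ) (π : ℕ → T → T) : ℕ → T → Ω → ℝ
  | 0, q => X q
  | k + 1, q => fun ω => X q ω - X (π k q) ω

/-- The sum `∑ exp(s |ζ| / w k)` over the increments `ζ` of level `k`, where
`w k = (1 - θ) * θ ^ k` are the weights with which the levels enter Hölder's inequality. -/
noncomputable def chainSum (X : T → Ω → ℝ) (V : ℕ → Finset T) (π : ℕ → T → T) (θ s : ℝ) (k : ℕ)
    (ω : Ω) : ℝ≥0∞ :=
  ∑ q ∈ V k, ENNReal.ofReal (Real.exp (s / ((1 - θ) * θ ^ k) * |chainIncrement X π k q ω|))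

lemma exp_abs_chainIncrement_le (hθ0 : 0 < θ) (hθ1 : θ < 1) {k : ℕ} {q : T} (hq : q ∈ V k)
    (ω : Ω) : ENNReal.ofReal (Real.exp (s * |chainIncrement X π k q ω|)) ≤
      chainSum X V π θ s k ω ^ ((1 - θ) * θ ^ k) := by
  have hw : 0 < (1 - θ) * θ ^ k := mul_pos (sub_pos.2 hθ1) (pow_pos hθ0 k)
  have hexp : Real.exp (s * |chainIncrement X π k q ω|) =
      Real.exp (s / ((1 - θ) * θ ^ k) * |chainIncrement X π k q ω|) ^ ((1 - θ) * θ ^ k) := by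
    rw [← Real.exp_mul, mul_right_comm, div_mul_cancel₀ _ hw.ne']
  rw [hexp, ← ENNReal.ofReal_rpow_of_pos (Real.exp_pos _)]
  exact ENNReal.rpow_le_rpow (Finset.single_le_sum (f := fun q => ENNReal.ofReal
    (Real.exp (s / ((1 - θ) * θ ^ k) * |chainIncrement X π k q ω|)))
    (fun _ _ => zero_le) hq) hw.le

variable [MeasurableSpace Ω] {P : Measure Ω} {φ : ℝ → ℝ} {E A β u : ℝ}

/-- Successive approximation sets `V 0, V 1, …` with projections `π k : V (k + 1) → V k` along
which the increments of `X` have `φ`-sub-Gaussian standard at most `θ ^ k * E`. -/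
structure IsGeometricChain (φ : ℝ → ℝ) (X : T → Ω → ℝ) (V : ℕ → Finset T) (π : ℕ → T → T)
    (E θ : ℝ) (P : Measure Ω) : Prop where
  proj_mem : ∀ k, ∀ q ∈ V (k + 1), π k q ∈ V k
  aemeasurable : ∀ k, ∀ q ∈ V k, AEMeasurable (chainIncrement X π k q) P
  expMomentLE : ∀ k, ∀ q ∈ V k, ExpMomentLE φ (θ ^ k * E) (chainIncrement X π k q) P

namespace IsGeometricChain

lemma exp_abs_le_prod (hX : IsGeometricChain φ X V π E θ P) (hθ0 : 0 < θ) (hθ1 : θ < 1)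
    (hs : 0 ≤ s) (ω : Ω) (k : ℕ) {q : T} (hq : q ∈ V k) :
    ENNReal.ofReal (Real.exp (s * |X q ω|)) ≤
      ∏ j ∈ Finset.range (k + 1), chainSum X V π θ s j ω ^ ((1 - θ) * θ ^ j) := by
  induction k generalizing q with
  | zero =>
    rw [Finset.prod_range_one]
    exact exp_abs_chainIncrement_le hθ0 hθ1 hq ω
  | succ k ih =>
    have htriangle : |X q ω| ≤ |X (π k q) ω| + |X q ω - X (π k q) ω| := by
      simpa only [add_sub_cancel] using abs_add_le (X (π k q) ω) (X q ω - X (π k q) ω)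
    rw [Finset.prod_range_succ]
    calc ENNReal.ofReal (Real.exp (s * |X q ω|))
        ≤ ENNReal.ofReal (Real.exp (s * |X (π k q) ω|) *
            Real.exp (s * |X q ω - X (π k q) ω|)) := by
          rw [← Real.exp_add, ← mul_add]
          gcongr
      _ ≤ _ := by
          rw [ENNReal.ofReal_mul (Real.exp_pos _).le]
          exact mul_le_mul' (ih (hX.proj_mem k q hq)) (exp_abs_chainIncrement_le hθ0 hθ1 hq ω)

lemma aemeasurable_chainSum (hX : IsGeometricChain φ X V π E θ P) (k : ℕ) :
    AEMeasurable (chainSum X V π θ s k) P :=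
  Finset.aemeasurable_fun_sum _ fun q hq =>
    aemeasurable_ofReal_exp ((hX.aemeasurable k q hq).abs.const_mul _)

lemma lintegral_chainSum_le (hX : IsGeometricChain φ X V π E θ P) (hφ : IsPreOrlicz φ)
    (hθ0 : 0 < θ) (k : ℕ) :
    ∫⁻ ω, chainSum X V π θ s k ω ∂P ≤
      (V k).card * (2 * ENNReal.ofReal (Real.exp (φ (E / (1 - θ) * s)))) := by
  have hscale : θ ^ k * E * (s / ((1 - θ) * θ ^ k)) = E / (1 - θ) * s := by
    have := (pow_pos hθ0 k).ne'
    field_simp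
  have hterm : ∀ q ∈ V k, ∫⁻ ω, ENNReal.ofReal
      (Real.exp (s / ((1 - θ) * θ ^ k) * |chainIncrement X π k q ω|)) ∂P ≤
        2 * ENNReal.ofReal (Real.exp (φ (E / (1 - θ) * s))) := fun q hq =>
    hscale ▸ (hX.expMomentLE k q hq).lintegral_exp_abs_le hφ (hX.aemeasurable k q hq) _
  simp only [chainSum]
  rw [lintegral_finsetSum' _ fun q hq =>
    aemeasurable_ofReal_exp ((hX.aemeasurable k q hq).abs.const_mul _), ← nsmul_eq_mul]
  exact Finset.sum_le_card_nsmul _ _ _ hterm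

lemma lintegral_prod_chainSum_le [IsProbabilityMeasure P] (hX : IsGeometricChain φ X V π E θ P)
    (hφ : IsPreOrlicz φ) (hθ0 : 0 < θ) (hθ1 : θ < 1) (hA : 1 ≤ A) (hβ : 0 ≤ β)
    (hcard : ∀ k, ((V k).card : ℝ) ≤ A * (θ ^ k) ^ (-β)) (n : ℕ) :
    ∫⁻ ω, ∏ j ∈ Finset.range n, chainSum X V π θ s j ω ^ ((1 - θ) * θ ^ j) ∂P ≤
      ENNReal.ofReal (2 * Real.exp (φ (E / (1 - θ) * s)) * (A * Real.exp β)) := by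
  have hw : ∀ k, 0 ≤ (1 - θ) * θ ^ k := fun k => mul_nonneg (sub_nonneg.2 hθ1.le) (by positivity)
  set B : ℝ := 2 * Real.exp (φ (E / (1 - θ) * s)) * A
  have hB : 1 ≤ B := one_le_mul_of_one_le_of_one_le
    (one_le_mul_of_one_le_of_one_le one_le_two (Real.one_le_exp (hφ.nonneg _))) hA
  have hB0 : 0 < B := one_pos.trans_le hB
  have hsum : ∀ k, ∫⁻ ω, chainSum X V π θ s k ω ∂P ≤
      ENNReal.ofReal (Real.exp (Real.log B + β * (k * -Real.log θ))) := fun k => by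
    refine (hX.lintegral_chainSum_le hφ hθ0 k).trans ?_
    rw [Real.exp_add, Real.exp_log hB0, show β * (k * -Real.log θ) = Real.log (θ ^ k) * -β by
        rw [Real.log_pow]; ring, ← Real.rpow_def_of_pos (pow_pos hθ0 k), mul_assoc _ A, mul_comm,
      ENNReal.ofReal_mul (by positivity), ENNReal.ofReal_mul zero_le_two, ENNReal.ofReal_ofNat]
    gcongr
    exact (ENNReal.ofReal_natCast _).symm.trans_le (ENNReal.ofReal_le_ofReal (hcard k))
  calc _ ≤ ∏ k ∈ Finset.range n, (∫⁻ ω, chainSum X V π θ s k ω ∂P) ^ ((1 - θ) * θ ^ k) :=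
        lintegral_prod_rpow_le_of_sum_le_one (fun k _ => hX.aemeasurable_chainSum k)
          (fun k _ => hw k) (sum_geometric_weight_le_one hθ0.le n)
    _ ≤ ∏ k ∈ Finset.range n, ENNReal.ofReal
          (Real.exp ((1 - θ) * θ ^ k * (Real.log B + β * (k * -Real.log θ)))) := by
        refine Finset.prod_le_prod' fun k _ => ?_
        rw [mul_comm ((1 - θ) * θ ^ k) (Real.log B + _), Real.exp_mul,
          ← ENNReal.ofReal_rpow_of_pos (Real.exp_pos _)]
        exact ENNReal.rpow_le_rpow (hsum k) (hw k)
    _ = ENNReal.ofReal (Real.exp (∑ k ∈ Finset.range n,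
          (1 - θ) * θ ^ k * (Real.log B + β * (k * -Real.log θ)))) := by
        rw [Real.exp_sum, ENNReal.ofReal_prod_of_nonneg fun k _ => (Real.exp_pos _).le]
    _ ≤ ENNReal.ofReal (Real.exp (Real.log B + β)) := by
        gcongr
        exact sum_geometric_weight_mul_log_le hθ0 hθ1 (Real.log_nonneg hB) hβ n
    _ = _ := by rw [Real.exp_add, Real.exp_log hB0, mul_assoc]

lemma measure_exists_mem_gt_le [IsProbabilityMeasure P] (hX : IsGeometricChain φ X V π E θ P)
    (hφ : IsPreOrlicz φ) (hθ0 : 0 < θ) (hθ1 : θ < 1) (hA : 1 ≤ A) (hβ : 0 ≤ β)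
    (hcard : ∀ k, ((V k).card : ℝ) ≤ A * (θ ^ k) ^ (-β)) (hs : 0 ≤ s) (k : ℕ) :
    P {ω | ∃ q ∈ V k, u < |X q ω|} ≤
      ENNReal.ofReal (2 * Real.exp (φ (E / (1 - θ) * s) - s * u) * (A * Real.exp β)) := by
  set S : Ω → ℝ≥0∞ := fun ω =>
    ∏ j ∈ Finset.range (k + 1), chainSum X V π θ s j ω ^ ((1 - θ) * θ ^ j)
  have hS : AEMeasurable S P := Finset.aemeasurable_fun_prod _ fun j _ =>
    (hX.aemeasurable_chainSum j).pow_const _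
  have hsub : {ω | ∃ q ∈ V k, u < |X q ω|} ⊆ {ω | ENNReal.ofReal (Real.exp (s * u)) ≤ S ω} := by
    rintro ω ⟨q, hq, hu⟩
    refine le_trans ?_ (hX.exp_abs_le_prod hθ0 hθ1 hs ω k hq)
    gcongr
  calc P {ω | ∃ q ∈ V k, u < |X q ω|}
      ≤ P {ω | ENNReal.ofReal (Real.exp (s * u)) ≤ S ω} := measure_mono hsub
    _ ≤ (∫⁻ ω, S ω ∂P) / ENNReal.ofReal (Real.exp (s * u)) :=
        meas_ge_le_lintegral_div hS (ENNReal.ofReal_pos.2 (Real.exp_pos _)).ne'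
          ENNReal.ofReal_ne_top
    _ ≤ ENNReal.ofReal (2 * Real.exp (φ (E / (1 - θ) * s)) * (A * Real.exp β)) /
          ENNReal.ofReal (Real.exp (s * u)) :=
        ENNReal.div_le_div_right (hX.lintegral_prod_chainSum_le hφ hθ0 hθ1 hA hβ hcard _) _
    _ = _ := by
        rw [← ENNReal.ofReal_div_of_pos (Real.exp_pos _), Real.exp_sub]
        congr 1
        ring

end IsGeometricChain

end Chain

section ChainRadius

variable {θ E C ρ : ℝ}

/-- The radius `r k` with `C * r k ^ ρ = θ ^ (k + 1) * E`, at which the increments of a field with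
Hölder constant `C` and exponent `ρ` are small enough for level `k + 1` of a geometric chain. -/
noncomputable def chainRadius (θ E C ρ : ℝ) (k : ℕ) : ℝ := (θ ^ (k + 1) * E / C) ^ (1 / ρ)

lemma chainRadius_pos (hθ0 : 0 < θ) (hE : 0 < E) (hC : 0 < C) (k : ℕ) :
    0 < chainRadius θ E C ρ k := by
  unfold chainRadius
  positivity

lemma mul_chainRadius_rpow (hθ0 : 0 < θ) (hE : 0 < E) (hC : 0 < C) (hρ : 0 < ρ) (k : ℕ) :
    C * chainRadius θ E C ρ k ^ ρ = θ ^ (k + 1) * E := by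
  rw [chainRadius, ← Real.rpow_mul (by positivity), one_div_mul_cancel hρ.ne', Real.rpow_one,
    mul_div_cancel₀ _ hC.ne']

lemma chainRadius_pow (hθ0 : 0 < θ) (hE : 0 < E) (hC : 0 < C) (k m : ℕ) :
    chainRadius θ E C ρ k ^ m = (θ * E) ^ (m / ρ) / C ^ (m / ρ) * (θ ^ k) ^ (m / ρ) := by
  rw [chainRadius, ← Real.rpow_mul_natCast (by positivity), one_div_mul_eq_div,
    ← Real.div_rpow (by positivity) hC.le, ← Real.mul_rpow (by positivity) (by positivity)]
  congr 1
  ring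

lemma chainRadius_le {h : ℝ} (hθ0 : 0 < θ) (hθ1 : θ < 1) (hE : 0 < E) (hC : 0 < C) (hρ : 0 < ρ)
    (hh : 0 ≤ h) (hθ : θ * E ≤ C * h ^ ρ) (k : ℕ) : chainRadius θ E C ρ k ≤ h := by
  rw [← Real.rpow_le_rpow_iff (chainRadius_pos hθ0 hE hC k).le hh hρ, ← mul_le_mul_iff_right₀ hC,
    mul_chainRadius_rpow hθ0 hE hC hρ]
  refine le_trans ?_ hθ
  gcongr
  exact pow_le_of_le_one hθ0.le hθ1.le k.succ_ne_zero

lemma tendsto_chainRadius (hθ0 : 0 ≤ θ) (hθ1 : θ < 1) (hρ : 0 < ρ) :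
    Tendsto (chainRadius θ E C ρ) atTop (𝓝 0) := by
  have hlim := (((tendsto_pow_atTop_nhds_zero_of_lt_one hθ0 hθ1).comp
    (tendsto_add_atTop_nat 1)).mul_const E).div_const C
  rw [zero_mul, zero_div] at hlim
  have hpow := hlim.rpow_const (p := 1 / ρ) (Or.inr (one_div_pos.2 hρ).le)
  rwa [Real.zero_rpow (one_div_pos.2 hρ).ne'] at hpow

end ChainRadius

lemma IsNet.exists_proj {E : Type*} [PseudoMetricSpace E] {V : Finset E} {h : ℝ} {D : Set E}
    (hV : IsNet V h D) : ∃ π : E → E, ∀ p ∈ D, π p ∈ V ∧ dist p (π p) ≤ h := by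
  classical
  choose π hπ using hV.exists_dist_le
  refine ⟨fun p => if hp : p ∈ D then π p hp else p, fun p hp => ?_⟩
  simpa only [dif_pos hp] using hπ p hp

section SupremumTail

variable {Ω T : Type*} [MeasurableSpace Ω] {P : Measure Ω} [PseudoMetricSpace T]
  {X : T → Ω → ℝ} {D : Set T} {E C L ρ θ s u : ℝ} {m : ℕ}

lemma measure_exists_gt_le_of_isNet {V : ℕ → Finset T} {r : ℕ → ℝ} {c : ℝ≥0∞}
    (hcont : ∀ᵐ ω ∂P, ContinuousOn (fun p => X p ω) D) (hV : ∀ k, IsNet (V k) (r k) D)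
    (hr : Tendsto r atTop (𝓝 0)) (hc : ∀ k, P {ω | ∃ q ∈ V k, u < |X q ω|} ≤ c) :
    P {ω | ∃ p ∈ D, u < |X p ω|} ≤ c := by
  have hsub : {ω | ∃ p ∈ D, u < |X p ω|} ≤ᵐ[P]
      {ω | ∀ᶠ k in atTop, ω ∈ {ω | ∃ q ∈ V k, u < |X q ω|}} := by
    filter_upwards [hcont] with ω hω
    rintro ⟨p, hp, hpu⟩
    obtain ⟨ε, hε, hnear⟩ := Metric.mem_nhdsWithin_iff.1
      ((hω.abs p hp).eventually (lt_mem_nhds hpu))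
    refine (hr.eventually (gt_mem_nhds hε)).mono fun k hk => ?_
    obtain ⟨q, hq, hpq⟩ := (hV k).exists_dist_le p hp
    exact ⟨q, hq, hnear ⟨Metric.mem_ball'.2 (hpq.trans_lt hk), (hV k).mem q hq⟩⟩
  exact (measure_mono_ae hsub).trans (measure_setOf_eventually_le hc)

namespace SubGaussianHolderOn

variable {φ : ℝ → ℝ}

lemma isGeometricChain (hX : SubGaussianHolderOn φ X C ρ D P)
    (hm : ∀ p ∈ D, AEMeasurable (X p) P) (hXE : ∀ p ∈ D, ExpMomentLE φ E (X p) P)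
    {V : ℕ → Finset T} {π : ℕ → T → T} {r : ℕ → ℝ} (hr : ∀ k, 0 < r k)
    (hrC : ∀ k, C * r k ^ ρ = θ ^ (k + 1) * E) (hV : ∀ k, IsNet (V k) (r k) D)
    (hπ : ∀ k, ∀ p ∈ D, π k p ∈ V k ∧ dist p (π k p) ≤ r k) :
    IsGeometricChain φ X V π E θ P where
  proj_mem k q hq := (hπ k q ((hV _).mem q hq)).1
  aemeasurable k q hq := by
    have hqD := (hV k).mem q hq
    cases k with
    | zero => exact hm q hqD
    | succ k => exact (hm q hqD).sub (hm _ ((hV k).mem _ (hπ k q hqD).1))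
  expMomentLE k q hq := by
    have hqD := (hV k).mem q hq
    cases k with
    | zero =>
      rw [pow_zero, one_mul]
      exact hXE q hqD
    | succ k =>
      rw [← hrC]
      exact hX q hqD _ ((hV k).mem _ (hπ k q hqD).1) _ (hr k) (hπ k q hqD).2

theorem measure_exists_gt_le [IsProbabilityMeasure P] (hX : SubGaussianHolderOn φ X C ρ D P)
    (hφ : IsPreOrlicz φ) (hm : ∀ p ∈ D, AEMeasurable (X p) P)
    (hcont : ∀ᵐ ω ∂P, ContinuousOn (fun p => X p ω) D) (hD : HasPolynomialNets D L m)
    (hXE : ∀ p ∈ D, ExpMomentLE φ E (X p) P) (hC : 0 < C) (hE : 0 < E) (hL : 0 ≤ L)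
    (hρ : 0 < ρ) (hθ0 : 0 < θ) (hθ1 : θ < 1) (hθ : θ * E ≤ C * (L / 2) ^ ρ) (hs : 0 ≤ s) :
    P {ω | ∃ p ∈ D, u < |X p ω|} ≤
      ENNReal.ofReal (2 * Real.exp (φ (E / (1 - θ) * s) - s * u) *
        (Real.exp 1 * C) ^ (m / ρ) * L ^ m * (θ * E) ^ (-(m / ρ))) := by
  have hr := chainRadius_pos (ρ := ρ) hθ0 hE hC
  have hrL : ∀ k, chainRadius θ E C ρ k ≤ L / 2 :=
    chainRadius_le hθ0 hθ1 hE hC hρ (by positivity) hθ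
  choose V hV hcard using fun k => hD _ (hr k) (hrL k)
  choose π hπ using fun k => (hV k).exists_proj
  set A : ℝ := L ^ m * C ^ (m / ρ) * (θ * E) ^ (-(m / ρ))
  have hA : ∀ k, (L / chainRadius θ E C ρ k) ^ m = A * (θ ^ k) ^ (-(m / ρ)) := fun k => by
    simp only [A]
    rw [div_pow, chainRadius_pow hθ0 hE hC, Real.rpow_neg (by positivity),
      Real.rpow_neg (by positivity)]
    field_simp
  have hA1 : 1 ≤ A := by
    have hA0 := hA 0
    rw [pow_zero, Real.one_rpow, mul_one] at hA0
    rw [← hA0]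
    exact one_le_pow₀ ((one_le_div (hr 0)).2 ((hrL 0).trans (half_le_self hL)))
  have hchain := hX.isGeometricChain hm hXE hr (mul_chainRadius_rpow hθ0 hE hC hρ) hV hπ
  refine (measure_exists_gt_le_of_isNet hcont hV (tendsto_chainRadius hθ0.le hθ1 hρ) fun k =>
    hchain.measure_exists_mem_gt_le hφ hθ0 hθ1 hA1 (by positivity)
      (fun k => (hcard k).trans_eq (hA k)) hs k).trans_eq ?_
  rw [Real.mul_rpow (Real.exp_pos 1).le hC.le, ← Real.exp_mul, one_mul]
  congr 1
  ring

end SubGaussianHolderOn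

end SupremumTail

section PowerOrlicz

variable {α γ u : ℝ}

lemma exists_powerOrlicz_mul_sub_eq {B : ℝ} (hαγ : α.HolderConjugate γ) (hB : 0 < B)
    (hu : 0 < u) : ∃ s, 0 ≤ s ∧ powerOrlicz α (B * s) - s * u = -((u / B) ^ γ / γ) := by
  have hx : 0 < u / B := by positivity
  have hpow : (u / B) ^ (γ - 1) * (u / B) = (u / B) ^ γ := by
    rw [Real.rpow_sub_one hx.ne', div_mul_cancel₀ _ hx.ne']
  refine ⟨(u / B) ^ (γ - 1) / B, by positivity, ?_⟩
  rw [mul_div_cancel₀ _ hB.ne', div_mul_eq_mul_div, mul_div_assoc, hpow, powerOrlicz,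
    abs_of_pos (by positivity), ← Real.rpow_mul hx.le, hαγ.symm.sub_one_mul_conj, div_eq_mul_inv,
    eq_sub_of_add_eq hαγ.inv_add_inv_eq_one]
  ring

variable {Ω T : Type*} {X : T → Ω → ℝ} {D : Set T}

lemma setOf_ofReal_lt_iSup_ofReal_abs (hu : 0 ≤ u) :
    {ω | ENNReal.ofReal u < ⨆ p ∈ D, ENNReal.ofReal |X p ω|} = {ω | ∃ p ∈ D, u < |X p ω|} := by
  ext ω
  simp only [mem_ofPred_eq, lt_iSup_iff, exists_prop,
    ENNReal.ofReal_lt_ofReal_iff_of_nonneg hu]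

variable [MeasurableSpace Ω] {P : Measure Ω} [IsProbabilityMeasure P] [PseudoMetricSpace T]
  {L ρ θ : ℝ} {m : ℕ}

lemma SubGaussianHolderOn.measure_lt_iSup_le {C S : ℝ≥0} (hαγ : α.HolderConjugate γ)
    (hX : SubGaussianHolderOn (powerOrlicz α) X C ρ D P) (hm : ∀ p ∈ D, AEMeasurable (X p) P)
    (hcont : ∀ᵐ ω ∂P, ContinuousOn (fun p => X p ω) D) (hD : HasPolynomialNets D L m)
    (hXS : ∀ p ∈ D, subGaussianStandard (powerOrlicz α) (X p) P ≤ S) (hC : 0 < C) (hS : 0 < S)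
    (hL : 0 < L) (hρ : 0 < ρ) (hθ0 : 0 < θ) (hθ1 : θ < 1) (hθ : θ * S ≤ C * (L / 2) ^ ρ)
    (hu : 0 < u) :
    P {ω | ENNReal.ofReal u < ⨆ p ∈ D, ENNReal.ofReal |X p ω|} ≤
      2 * ENNReal.ofReal (Real.exp (-(u ^ γ * (1 - θ) ^ γ / (γ * S ^ γ)))) *
        (ENNReal.ofReal (Real.exp 1) * C) ^ (m / ρ) * ENNReal.ofReal L ^ m *
        (ENNReal.ofReal θ * S) ^ (-(m / ρ)) := by
  have h1θ : 0 < 1 - θ := sub_pos.2 hθ1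
  have hφ := isPreOrlicz_powerOrlicz hαγ.pos
  obtain ⟨s, hs, hrate⟩ := exists_powerOrlicz_mul_sub_eq hαγ (B := S / (1 - θ)) (by positivity) hu
  rw [div_div_eq_mul_div, Real.div_rpow (by positivity) S.coe_nonneg,
    Real.mul_rpow hu.le h1θ.le, div_div, mul_comm (_ ^ γ) γ] at hrate
  have hXE : ∀ p ∈ D, ExpMomentLE (powerOrlicz α) S (X p) P := fun p hp => by
    rw [← subGaussianStandard_le_ofReal_iff hφ S.coe_nonneg, ENNReal.ofReal_coe_nnreal]
    exact hXS p hp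
  rw [setOf_ofReal_lt_iSup_ofReal_abs hu.le]
  refine (hX.measure_exists_gt_le hφ hm hcont hD hXE hC hS hL.le hρ hθ0 hθ1 hθ hs).trans_eq ?_
  rw [hrate, ENNReal.ofReal_mul (by positivity), ENNReal.ofReal_mul (by positivity),
    ENNReal.ofReal_mul (by positivity), ENNReal.ofReal_mul zero_le_two, ENNReal.ofReal_ofNat,
    ENNReal.ofReal_pow hL.le, ← ENNReal.ofReal_rpow_of_pos (by positivity),
    ← ENNReal.ofReal_rpow_of_pos (by positivity), ENNReal.ofReal_mul (Real.exp_pos 1).le,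
    ENNReal.ofReal_mul hθ0.le, ENNReal.ofReal_coe_nnreal, ENNReal.ofReal_coe_nnreal]

theorem measure_lt_iSup_le_of_subGaussianStandard_sub_le {C S : ℝ≥0∞}
    (hαγ : α.HolderConjugate γ)
    (hX : ∀ p ∈ D, ∀ q ∈ D, ∀ h : ℝ, 0 < h → dist p q ≤ h →
      subGaussianStandard (powerOrlicz α) (fun ω => X p ω - X q ω) P ≤ C * ENNReal.ofReal (h ^ ρ))
    (hm : ∀ p ∈ D, AEMeasurable (X p) P) (hcont : ∀ᵐ ω ∂P, ContinuousOn (fun p => X p ω) D)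
    (hm0 : m ≠ 0) (hD : HasPolynomialNets D L m)
    (hXS : ∀ p ∈ D, subGaussianStandard (powerOrlicz α) (X p) P ≤ S) (hS_top : S ≠ ∞)
    (hρ : 0 < ρ) (hθ0 : 0 < θ) (hθ1 : θ < 1)
    (hθ : ENNReal.ofReal θ * S < C * ENNReal.ofReal (L / 2) ^ ρ) (hu : 0 < u) :
    P {ω | ENNReal.ofReal u < ⨆ p ∈ D, ENNReal.ofReal |X p ω|} ≤
      2 * ENNReal.ofReal (Real.exp (-(u ^ γ * (1 - θ) ^ γ / (γ * S.toReal ^ γ)))) *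
        (ENNReal.ofReal (Real.exp 1) * C) ^ (m / ρ) * ENNReal.ofReal L ^ m *
        (ENNReal.ofReal θ * S) ^ (-(m / ρ)) := by
  have hmρ : 0 < m / ρ := by positivity
  have hC : C ≠ 0 := left_ne_zero_of_mul (pos_of_gt hθ).ne'
  have hL : 0 < L := by
    by_contra! hL
    rw [ENNReal.ofReal_of_nonpos (p := L / 2) (by linarith), ENNReal.zero_rpow_of_pos hρ,
      mul_zero] at hθ
    exact not_lt_zero hθ
  have hexp : ∀ x, ENNReal.ofReal (Real.exp x) ≠ 0 := fun x =>
    (ENNReal.ofReal_pos.2 (Real.exp_pos x)).ne'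
  have hL0 : ENNReal.ofReal L ^ m ≠ 0 := pow_ne_zero _ (ENNReal.ofReal_pos.2 hL).ne'
  rcases eq_or_ne S 0 with rfl | hS
  · have hbase : (ENNReal.ofReal (Real.exp 1) * C) ^ (m / ρ) ≠ 0 := by
      rw [Ne, ENNReal.rpow_eq_zero_iff_of_pos hmρ]
      exact mul_ne_zero (hexp 1) hC
    rw [mul_zero, ENNReal.zero_rpow_of_neg (neg_lt_zero.2 hmρ), ENNReal.mul_top
      (mul_ne_zero (mul_ne_zero (mul_ne_zero two_ne_zero (hexp _)) hbase) hL0)]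
    exact le_top
  rcases eq_or_ne C ∞ with rfl | hC_top
  · have hS_rpow : (ENNReal.ofReal θ * S) ^ (-(m / ρ)) ≠ 0 := by
      rw [ENNReal.rpow_neg]
      exact ENNReal.inv_ne_zero.2 (ENNReal.rpow_ne_top_of_nonneg hmρ.le
        (ENNReal.mul_ne_top ENNReal.ofReal_ne_top hS_top))
    rw [ENNReal.mul_top (hexp 1), ENNReal.top_rpow_of_pos hmρ,
      ENNReal.mul_top (mul_ne_zero two_ne_zero (hexp _)), ENNReal.top_mul hL0,
      ENNReal.top_mul hS_rpow]
    exact le_top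
  lift S to ℝ≥0 using hS_top
  lift C to ℝ≥0 using hC_top
  rw [← ENNReal.ofReal_coe_nnreal (p := S), ← ENNReal.ofReal_coe_nnreal (p := C),
    ENNReal.ofReal_rpow_of_pos (by positivity), ← ENNReal.ofReal_mul hθ0.le,
    ← ENNReal.ofReal_mul C.coe_nonneg] at hθ
  have hC0 := pos_iff_ne_zero.2 (ENNReal.coe_ne_zero.1 hC)
  exact ((subGaussianHolderOn_iff (isPreOrlicz_powerOrlicz hαγ.pos)).2 hX).measure_lt_iSup_le hαγ
    hm hcont hD hXS hC0 (pos_iff_ne_zero.2 (ENNReal.coe_ne_zero.1 hS)) hL hρ hθ0 hθ1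
    ((ENNReal.ofReal_lt_ofReal_iff_of_nonneg (by positivity)).1 hθ).le hu

end PowerOrlicz

/-! ### The kernel -/

section Kernel

lemma continuous_of_abs_sub_le_two_mul_abs_sin {κ : ℝ → ℝ}
    (hκ : ∀ u v, |κ u - κ v| ≤ 2 * |Real.sin ((u - v) / 2)|) : Continuous κ := by
  refine (LipschitzWith.of_dist_le_mul (K := 1) fun u v => (hκ u v).trans ?_).continuous
  rw [NNReal.coe_one, one_mul, Real.dist_eq]
  have hsin := Real.abs_sin_le_abs (x := (u - v) / 2)
  rw [abs_div, abs_two] at hsin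
  linarith

lemma abs_le_of_abs_sub_le_two_mul_abs_sin {κ : ℝ → ℝ}
    (hκ : ∀ u v, |κ u - κ v| ≤ 2 * |Real.sin ((u - v) / 2)|) (u : ℝ) : |κ u| ≤ |κ 0| + 2 := by
  linarith [hκ u 0, Real.abs_sin_le_one ((u - 0) / 2), abs_sub_abs_le_abs_sub (κ u) (κ 0)]

lemma abs_sub_le_two_mul_abs_sin {κ : ℝ → ℝ} (hκ : κ = Real.cos ∨ κ = Real.sin) (u v : ℝ) :
    |κ u - κ v| ≤ 2 * |Real.sin ((u - v) / 2)| := by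
  rcases hκ with rfl | rfl
  · rw [Real.cos_sub_cos, abs_mul, abs_mul, abs_neg, abs_two]
    nlinarith [Real.abs_sin_le_one ((u + v) / 2), abs_nonneg (Real.sin ((u - v) / 2))]
  · rw [Real.sin_sub_sin, abs_mul, abs_mul, abs_two]
    nlinarith [Real.abs_cos_le_one ((u + v) / 2), abs_nonneg (Real.sin ((u - v) / 2))]

lemma abs_sin_le_rpow {ρ : ℝ} (hρ0 : 0 < ρ) (hρ1 : ρ ≤ 1) (z : ℝ) : |Real.sin z| ≤ |z| ^ ρ := by
  rcases le_total |z| 1 with hz | hz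
  · exact Real.abs_sin_le_abs.trans (Real.self_le_rpow_of_le_one (abs_nonneg z) hz hρ1)
  · exact (Real.abs_sin_le_one z).trans (Real.one_le_rpow hz hρ0.le)

lemma abs_sin_add_le (u v : ℝ) : |Real.sin (u + v)| ≤ |Real.sin u| + |Real.sin v| := by
  rw [Real.sin_add]
  refine (abs_add_le _ _).trans (add_le_add ?_ ?_) <;> rw [abs_mul]
  · exact mul_le_of_le_one_right (abs_nonneg _) (Real.abs_cos_le_one v)
  · exact mul_le_of_le_one_left (abs_nonneg _) (Real.abs_cos_le_one u)

variable (N : ℕ) (coef : ℕ → ℝ) {κ : ℝ → ℝ} {ρ : ℝ}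

lemma continuous_dispersionPoly : Continuous (dispersionPoly N coef) := by
  unfold dispersionPoly
  fun_prop

lemma continuous_solutionKernel (hκ : Continuous κ) (t x : ℝ) :
    Continuous (solutionKernel κ N coef t x) :=
  hκ.comp ((continuous_mul_const x).add (continuous_const.mul (continuous_dispersionPoly N coef)))

lemma abs_solutionKernel_sub_le (hκ : ∀ u v, |κ u - κ v| ≤ 2 * |Real.sin ((u - v) / 2)|)
    (hρ0 : 0 < ρ) (hρ1 : ρ ≤ 1) {h t t₁ x x₁ : ℝ} (ht : |t - t₁| ≤ h) (hx : |x - x₁| ≤ h)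
    (l : ℝ) : |solutionKernel κ N coef t x l - solutionKernel κ N coef t₁ x₁ l| ≤
      2 * h ^ ρ * holderWeight N coef ρ l := by
  have hsin {z : ℝ} (w : ℝ) (hz : |z| ≤ h) : |Real.sin (z * w)| ≤ h ^ ρ * |w| ^ ρ := by
    refine (abs_sin_le_rpow hρ0 hρ1 _).trans ?_
    rw [abs_mul, Real.mul_rpow (abs_nonneg _) (abs_nonneg _)]
    gcongr
  have hphase : (l * x + t * dispersionPoly N coef l -
      (l * x₁ + t₁ * dispersionPoly N coef l)) / 2 =
      (x - x₁) * (l / 2) + (t - t₁) * (1 / 2 * dispersionPoly N coef l) := by ring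
  calc |solutionKernel κ N coef t x l - solutionKernel κ N coef t₁ x₁ l|
      ≤ 2 * |Real.sin ((x - x₁) * (l / 2) + (t - t₁) * (1 / 2 * dispersionPoly N coef l))| :=
        (hκ _ _).trans_eq (by rw [hphase])
    _ ≤ 2 * (h ^ ρ * |l / 2| ^ ρ + h ^ ρ * |1 / 2 * dispersionPoly N coef l| ^ ρ) := by
        gcongr
        exact (abs_sin_add_le _ _).trans (add_le_add (hsin _ hx) (hsin _ ht))
    _ = 2 * h ^ ρ * holderWeight N coef ρ l := by
        rw [holderWeight, abs_div, abs_two]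
        ring

lemma exists_abs_dispersionPoly_le :
    ∃ A : ℝ, 0 ≤ A ∧
      ∀ l m : ℝ, |l| ≤ m → 1 ≤ m → |dispersionPoly N coef l| ≤ A * m ^ (2 * N + 1) := by
  refine ⟨∑ k ∈ Finset.Icc 1 N, |coef k|, Finset.sum_nonneg fun _ _ => abs_nonneg _,
    fun l m hl hm => (Finset.abs_sum_le_sum_abs _ _).trans ?_⟩
  rw [Finset.sum_mul]
  refine Finset.sum_le_sum fun k hk => ?_
  rw [abs_mul, abs_mul, abs_pow, abs_pow, abs_neg, abs_one, one_pow, mul_one]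
  have hkN := (Finset.mem_Icc.1 hk).2
  gcongr
  exact (pow_le_pow_left₀ (abs_nonneg l) hl _).trans (pow_le_pow_right₀ hm (by omega))

lemma exists_holderWeight_le (hρ : 0 < ρ) {q : ℝ} (hq : (2 * N + 1) * ρ ≤ q) :
    ∃ C : ℝ, 0 < C ∧ ∀ l, holderWeight N coef ρ l ≤ C * (1 + |l| ^ q) := by
  obtain ⟨A, hA, hpoly⟩ := exists_abs_dispersionPoly_le N coef
  refine ⟨1 + A ^ ρ, by positivity, fun l => ?_⟩
  set m := max 1 |l| with hm_def
  have hm : 1 ≤ m := le_max_left _ _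
  have hlm : |l| ≤ m := le_max_right _ _
  have hm0 : 0 < m := one_pos.trans_le hm
  have hρq : ρ ≤ q := (le_mul_of_one_le_left hρ.le (by simp)).trans hq
  have hlin : (|l| / 2) ^ ρ ≤ m ^ q :=
    (Real.rpow_le_rpow (by positivity) (by linarith [abs_nonneg l]) hρ.le).trans
      (Real.rpow_le_rpow_of_exponent_le hm hρq)
  have hdisp : |1 / 2 * dispersionPoly N coef l| ^ ρ ≤ A ^ ρ * m ^ q :=
    calc |1 / 2 * dispersionPoly N coef l| ^ ρ ≤ (A * m ^ (2 * N + 1)) ^ ρ := by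
          refine Real.rpow_le_rpow (abs_nonneg _) ?_ hρ.le
          rw [abs_mul, abs_of_pos one_half_pos]
          linarith [hpoly l m hlm hm, abs_nonneg (dispersionPoly N coef l)]
      _ = A ^ ρ * m ^ ((2 * N + 1) * ρ) := by
          rw [Real.mul_rpow hA (by positivity), ← Real.rpow_natCast_mul hm0.le]
          push_cast
          rfl
      _ ≤ A ^ ρ * m ^ q := by gcongr
  have hmq : m ^ q ≤ 1 + |l| ^ q := by
    rcases max_cases 1 |l| with ⟨hmax, -⟩ | ⟨hmax, -⟩ <;> rw [hm_def, hmax]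
    · rw [Real.one_rpow]
      exact le_add_of_nonneg_right (by positivity)
    · exact le_add_of_nonneg_left zero_le_one
  calc holderWeight N coef ρ l ≤ (1 + A ^ ρ) * m ^ q := by
        rw [one_add_mul]
        exact add_le_add hlin hdisp
    _ ≤ (1 + A ^ ρ) * (1 + |l| ^ q) := by gcongr

end Kernel

/-! ### The random field -/

section SolutionField

lemma tendsto_abs_rpow_cocompact {q : ℝ} (hq : 0 < q) :
    Tendsto (fun l : ℝ => |l| ^ q) (cocompact ℝ) atTop :=
  (tendsto_rpow_atTop hq).comp tendsto_norm_cocompact_atTop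

variable {Ω : Type*} [MeasurableSpace Ω] {P : Measure Ω} {φ : ℝ → ℝ} {y : ℝ → Ω → ℝ} {Cy : ℝ≥0}
  {κ : ℝ → ℝ} {N : ℕ} {coef : ℕ → ℝ} {ρ q L : ℝ} {m : ℕ} {D : Set (ℝ × ℝ)} {U : ℝ × ℝ → Ω → ℝ}

lemma IsSolutionField.subGaussianStandard_sub_le (hU : IsSolutionField κ N coef y D U P)
    (hκ : ∀ u v, |κ u - κ v| ≤ 2 * |Real.sin ((u - v) / 2)|)
    (hs : IsStrictlyPhiSubGaussian φ y Cy P) (hφ : IsPreOrlicz φ)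
    (hvar : HasFiniteVitaliVariation (covFun y P)) (hρ0 : 0 < ρ) (hρ1 : ρ ≤ 1) {p p' : ℝ × ℝ}
    (hp : p ∈ D) (hp' : p' ∈ D) {h : ℝ} (hh : 0 < h) (hpp' : dist p p' ≤ h) :
    subGaussianStandard φ (fun ω => U p ω - U p' ω) P ≤
      2 * constCZ (covFun y P) N coef ρ * Cy * ENNReal.ofReal (h ^ ρ) := by
  have hcont := continuous_solutionKernel N coef (continuous_of_abs_sub_le_two_mul_abs_sin hκ)
  have hJ := (hU p hp).sub hs.memLp (hU p' hp')
  calc subGaussianStandard φ (fun ω => U p ω - U p' ω) P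
      ≤ Cy * (ENNReal.ofReal (2 * h ^ ρ) * constCZ (covFun y P) N coef ρ) :=
        (hs.subGaussianStandard_le hφ hJ).trans <| mul_le_mul_right (hJ.eLpNorm_le hs.memLp hvar
          ((hcont _ _).sub (hcont _ _)) (by positivity)
          (abs_solutionKernel_sub_le N coef hκ hρ0 hρ1 ((le_max_left _ _).trans hpp')
            ((le_max_right _ _).trans hpp'))) _
    _ = 2 * constCZ (covFun y P) N coef ρ * Cy * ENNReal.ofReal (h ^ ρ) := by
        rw [ENNReal.ofReal_mul zero_le_two, ENNReal.ofReal_ofNat]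
        ring

lemma exists_subGaussianStandard_sub_le
    (hκ : ∀ u v, |κ u - κ v| ≤ 2 * |Real.sin ((u - v) / 2)|)
    (hs : IsStrictlyPhiSubGaussian φ y Cy P) (hφ : IsPreOrlicz φ)
    (hvar : HasFiniteVitaliVariation (covFun y P)) (hρ0 : 0 < ρ) (hρ1 : ρ ≤ 1)
    (hq : (2 * N + 1) * ρ ≤ q) (hqV : variationNorm (covFun y P) (fun l => |l| ^ q) ≠ ∞) :
    ∃ K : ℝ≥0, ∀ U : ℝ × ℝ → Ω → ℝ, IsSolutionField κ N coef y D U P →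
      ∀ p ∈ D, ∀ p' ∈ D, ∀ h : ℝ, 0 < h → dist p p' ≤ h →
        subGaussianStandard φ (fun ω => U p ω - U p' ω) P ≤ K * ENNReal.ofReal (h ^ ρ) := by
  have hq0 : 0 < q := lt_of_lt_of_le (by positivity) hq
  have hcont := continuous_solutionKernel N coef (continuous_of_abs_sub_le_two_mul_abs_sin hκ)
  obtain ⟨V, hV⟩ := hvar
  obtain ⟨C, hC, hweight⟩ := exists_holderWeight_le N coef hρ0 hq
  obtain ⟨W, hW⟩ : ∃ W : ℝ≥0, W = variationNorm (covFun y P) (fun _ => 1) +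
      variationNorm (covFun y P) (fun l => |l| ^ q) :=
    WithTop.ne_top_iff_exists.1 (ENNReal.add_ne_top.2 ⟨(variationNorm_one_lt_top hV).ne, hqV⟩)
  refine ⟨Cy * (2 * C.toNNReal * W), fun U hU p hp p' hp' h hh hpp' => ?_⟩
  have hJ := (hU p hp).sub hs.memLp (hU p' hp')
  have hf (l : ℝ) : |solutionKernel κ N coef p.1 p.2 l - solutionKernel κ N coef p'.1 p'.2 l| ≤
      2 * h ^ ρ * C * (1 + |l| ^ q) :=
    calc _ ≤ 2 * h ^ ρ * holderWeight N coef ρ l :=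
          abs_solutionKernel_sub_le N coef hκ hρ0 hρ1 ((le_max_left _ _).trans hpp')
            ((le_max_right _ _).trans hpp') l
      _ ≤ 2 * h ^ ρ * C * (1 + |l| ^ q) := by
          rw [mul_assoc _ C]
          exact mul_le_mul_of_nonneg_left (hweight l) (by positivity)
  calc subGaussianStandard φ (fun ω => U p ω - U p' ω) P
      ≤ Cy * (ENNReal.ofReal (2 * h ^ ρ * C) * W) := by
        rw [hW]
        exact (hs.subGaussianStandard_le hφ hJ).trans <| mul_le_mul_right (hJ.eLpNorm_le_add
          hs.memLp ⟨V, hV⟩ (continuous_abs.rpow_const fun _ => Or.inr hq0.le)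
          (fun _ => by positivity) (tendsto_abs_rpow_cocompact hq0) hqV
          ((hcont _ _).sub (hcont _ _)) (by positivity) hf) _
    _ = (Cy * (2 * C.toNNReal * W) : ℝ≥0) * ENNReal.ofReal (h ^ ρ) := by
        rw [ENNReal.ofReal_mul (by positivity), ENNReal.ofReal_mul zero_le_two,
          ENNReal.ofReal_ofNat, ← ENNReal.ofNNReal_toNNReal C]
        push_cast
        ring

lemma IsSolutionField.supStandard_lt_top (hU : IsSolutionField κ N coef y D U P)
    (hκ : ∀ u v, |κ u - κ v| ≤ 2 * |Real.sin ((u - v) / 2)|)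
    (hs : IsStrictlyPhiSubGaussian φ y Cy P) (hφ : IsPreOrlicz φ)
    (hvar : HasFiniteVitaliVariation (covFun y P)) : supStandard φ D U P < ∞ := by
  have hcont := continuous_solutionKernel N coef (continuous_of_abs_sub_le_two_mul_abs_sin hκ)
  obtain ⟨V, hV⟩ := hvar
  have hle : ∀ p ∈ D, subGaussianStandard φ (U p) P ≤ Cy * (ENNReal.ofReal (|κ 0| + 2) *
      variationNorm (covFun y P) (fun _ => 1)) := fun p hp =>
    (hs.subGaussianStandard_le hφ (hU p hp)).trans <| mul_le_mul_right ((hU p hp).eLpNorm_le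
      hs.memLp ⟨V, hV⟩ (hcont _ _) (by positivity) fun l => by
        rw [mul_one]
        exact abs_le_of_abs_sub_le_two_mul_abs_sin hκ _) _
  exact (iSup₂_le hle).trans_lt (ENNReal.mul_lt_top ENNReal.coe_lt_top
    (ENNReal.mul_lt_top ENNReal.ofReal_lt_top (variationNorm_one_lt_top hV)))

lemma exists_continuous_solutionField
    (hκ : ∀ u v, |κ u - κ v| ≤ 2 * |Real.sin ((u - v) / 2)|)
    (hs : IsStrictlyPhiSubGaussian φ y Cy P) (hφ : IsPreOrlicz φ)
    (hvar : HasFiniteVitaliVariation (covFun y P)) (hρ0 : 0 < ρ) (hρ1 : ρ ≤ 1)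
    (hq : (2 * N + 1) * ρ ≤ q) (hqV : variationNorm (covFun y P) (fun l => |l| ^ q) ≠ ∞)
    (hL : 0 < L) (hD : HasPolynomialNets D L m) :
    ∃ U : ℝ × ℝ → Ω → ℝ, IsSolutionField κ N coef y D U P ∧ HasContinuousPathsOn D U P := by
  have hcont := continuous_solutionKernel N coef (continuous_of_abs_sub_le_two_mul_abs_sin hκ)
  have hq0 : 0 < q := lt_of_lt_of_le (by positivity) hq
  have hX (p : ℝ × ℝ) : ∃ J, IsMeanSquareIntegral (solutionKernel κ N coef p.1 p.2) y J P :=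
    exists_isMeanSquareIntegral hs.memLp hvar (tendsto_abs_rpow_cocompact hq0) hqV (hcont _ _)
      fun l => abs_le_of_abs_sub_le_two_mul_abs_sin hκ _
  choose X hX using hX
  obtain ⟨K, hK⟩ := exists_subGaussianStandard_sub_le (D := D) hκ hs hφ hvar hρ0 hρ1 hq hqV
  have hX_holder : SubGaussianHolderOn φ X (K + 1 : ℝ≥0) ρ D P :=
    (subGaussianHolderOn_iff hφ).2 fun p hp p' hp' h hh hpp' =>
      (hK X (fun p _ => hX p) p hp p' hp' h hh hpp').trans <| mul_le_mul_left
        (ENNReal.coe_le_coe.2 le_self_add) _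
  obtain ⟨U, hXU, hU⟩ := hX_holder.exists_continuous_modification hφ
    (fun p => (hX p).1.aestronglyMeasurable.aemeasurable) (by positivity) hρ0 hL hD
  exact ⟨U, fun p hp => (hX p).congr (hXU p hp), hU⟩

lemma IsSolutionField.measure_lt_iSup_le [IsProbabilityMeasure P] {α γ θ u : ℝ}
    (hU : IsSolutionField κ N coef y D U P) (hcont : HasContinuousPathsOn D U P)
    (hκ : ∀ u v, |κ u - κ v| ≤ 2 * |Real.sin ((u - v) / 2)|) (hαγ : α.HolderConjugate γ)
    (hs : IsStrictlyPhiSubGaussian (powerOrlicz α) y Cy P)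
    (hvar : HasFiniteVitaliVariation (covFun y P)) (hρ0 : 0 < ρ) (hρ1 : ρ ≤ 1) (hm : m ≠ 0)
    (hD : HasPolynomialNets D L m) (hθ0 : 0 < θ) (hθ1 : θ < 1)
    (hθ : ENNReal.ofReal θ * supStandard (powerOrlicz α) D U P <
      2 * constCZ (covFun y P) N coef ρ * Cy * ENNReal.ofReal (L / 2) ^ ρ) (hu : 0 < u) :
    P {ω | ENNReal.ofReal u < ⨆ p ∈ D, ENNReal.ofReal |U p ω|} ≤
      2 * ENNReal.ofReal (Real.exp (-(u ^ γ * (1 - θ) ^ γ /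
          (γ * (supStandard (powerOrlicz α) D U P).toReal ^ γ)))) *
        (2 * ENNReal.ofReal (Real.exp 1) * constCZ (covFun y P) N coef ρ * Cy) ^ (m / ρ) *
        ENNReal.ofReal L ^ m *
        (ENNReal.ofReal θ * supStandard (powerOrlicz α) D U P) ^ (-(m / ρ)) := by
  have hφ := isPreOrlicz_powerOrlicz hαγ.pos
  have hcomm : 2 * ENNReal.ofReal (Real.exp 1) * constCZ (covFun y P) N coef ρ * Cy =
      ENNReal.ofReal (Real.exp 1) * (2 * constCZ (covFun y P) N coef ρ * Cy) := by ring
  rw [hcomm]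
  exact measure_lt_iSup_le_of_subGaussianStandard_sub_le hαγ
    (fun p hp p' hp' h hh hpp' => hU.subGaussianStandard_sub_le hκ hs hφ hvar hρ0 hρ1 hp hp' hh
      hpp') (fun p hp => (hU p hp).1.aestronglyMeasurable.aemeasurable) hcont hm hD
    (fun p hp => le_iSup₂ (f := fun p (_ : p ∈ D) => subGaussianStandard (powerOrlicz α) (U p) P)
      p hp) (hU.supStandard_lt_top hκ hs hφ hvar).ne hρ0 hθ0 hθ1 hθ hu

end SolutionField

theorem mainTheorem2_general {Ω : Type*} [MeasurableSpace Ω] (P : Measure Ω)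
    [IsProbabilityMeasure P] (N : ℕ) (coef : ℕ → ℝ) (κ : ℝ → ℝ)
    (hκ : ∀ u v, |κ u - κ v| ≤ 2 * |Real.sin ((u - v) / 2)|)
    (a b c d : ℝ) (hab : a ≤ b) (hcd : c ≤ d)
    (ρ : ℝ) (hρ0 : 0 < ρ) (hρ1 : ρ ≤ 1) (q : ℝ) (hq : (2 * N + 1) * ρ ≤ q)
    (y : ℝ → Ω → ℝ)
    (hvar : HasFiniteVitaliVariation (covFun y P))
    (hint : variationIntegral (covFun y P) (fun l m =>
        ENNReal.ofReal (|l| ^ q * |m| ^ q)) < ∞) :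
    (∀ α : ℝ, 1 < α → ∀ Cy : ℝ≥0, IsStrictlyPhiSubGaussian (powerOrlicz α) y Cy P →
      (∃ U : ℝ × ℝ → Ω → ℝ,
        IsSolutionField κ N coef y (Icc a b ×ˢ Icc c d) U P ∧
        HasContinuousPathsOn (Icc a b ×ˢ Icc c d) U P) ∧
      (∀ U : ℝ × ℝ → Ω → ℝ,
        IsSolutionField κ N coef y (Icc a b ×ˢ Icc c d) U P →
        ∀ h : ℝ, 0 < h → ∀ t ∈ Icc a b, ∀ t₁ ∈ Icc a b, ∀ x ∈ Icc c d, ∀ x₁ ∈ Icc c d,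
          |t - t₁| ≤ h → |x - x₁| ≤ h →
          subGaussianStandard (powerOrlicz α) (fun ω => U (t, x) ω - U (t₁, x₁) ω) P
            ≤ 2 * constCZ (covFun y P) N coef ρ * Cy * ENNReal.ofReal (h ^ ρ)) ∧
      (∃ K : ℝ≥0, ∀ U : ℝ × ℝ → Ω → ℝ,
        IsSolutionField κ N coef y (Icc a b ×ˢ Icc c d) U P →
        ∀ h : ℝ, 0 < h → ∀ t ∈ Icc a b, ∀ t₁ ∈ Icc a b, ∀ x ∈ Icc c d, ∀ x₁ ∈ Icc c d,
          |t - t₁| ≤ h → |x - x₁| ≤ h →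
          subGaussianStandard (powerOrlicz α) (fun ω => U (t, x) ω - U (t₁, x₁) ω) P
            ≤ (K : ℝ≥0∞) * ENNReal.ofReal (h ^ ρ)) ∧
      (∀ U : ℝ × ℝ → Ω → ℝ,
        IsSolutionField κ N coef y (Icc a b ×ˢ Icc c d) U P →
        HasContinuousPathsOn (Icc a b ×ˢ Icc c d) U P →
        supStandard (powerOrlicz α) (Icc a b ×ˢ Icc c d) U P < ∞ ∧
        ∀ θ : ℝ, 0 < θ → θ < 1 →
          ENNReal.ofReal θ * supStandard (powerOrlicz α) (Icc a b ×ˢ Icc c d) U P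
            < 2 * constCZ (covFun y P) N coef ρ * Cy *
              ENNReal.ofReal (max (b - a) (d - c) / 2) ^ ρ →
          ∀ γ : ℝ, 1 / α + 1 / γ = 1 → ∀ u : ℝ, 0 < u →
            P {ω | ENNReal.ofReal u <
                ⨆ p ∈ Icc a b ×ˢ Icc c d, ENNReal.ofReal |U p ω|}
              ≤ 2 * ENNReal.ofReal (Real.exp (-(u ^ γ * (1 - θ) ^ γ /
                  (γ * (supStandard (powerOrlicz α) (Icc a b ×ˢ Icc c d) U P).toReal ^ γ)))) *
                (2 * ENNReal.ofReal (Real.exp 1) * constCZ (covFun y P) N coef ρ * Cy)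
                  ^ (2 / ρ) *
                ENNReal.ofReal (max (b - a) (d - c)) ^ 2 *
                (ENNReal.ofReal θ * supStandard (powerOrlicz α) (Icc a b ×ˢ Icc c d) U P)
                  ^ (-(2 / ρ)))) ∧
    (IsGaussianProcess y P → (∀ s, ∫ ω, y s ω ∂P = 0) →
      (∃ U : ℝ × ℝ → Ω → ℝ,
        IsSolutionField κ N coef y (Icc a b ×ˢ Icc c d) U P ∧
        HasContinuousPathsOn (Icc a b ×ˢ Icc c d) U P) ∧
      (∀ U : ℝ × ℝ → Ω → ℝ,
        IsSolutionField κ N coef y (Icc a b ×ˢ Icc c d) U P →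
        HasContinuousPathsOn (Icc a b ×ˢ Icc c d) U P →
        supStandard (powerOrlicz 2) (Icc a b ×ˢ Icc c d) U P < ∞ ∧
        ∀ θ : ℝ, 0 < θ → θ < 1 →
          ENNReal.ofReal θ * supStandard (powerOrlicz 2) (Icc a b ×ˢ Icc c d) U P
            < 2 * constCZ (covFun y P) N coef ρ *
              ENNReal.ofReal (max (b - a) (d - c) / 2) ^ ρ →
          ∀ u : ℝ, 0 < u →
            P {ω | ENNReal.ofReal u <
                ⨆ p ∈ Icc a b ×ˢ Icc c d, ENNReal.ofReal |U p ω|}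
              ≤ 2 * ENNReal.ofReal (Real.exp (-(u ^ 2 * (1 - θ) ^ 2 /
                  (2 * (supStandard (powerOrlicz 2) (Icc a b ×ˢ Icc c d) U P).toReal ^ 2)))) *
                (2 * ENNReal.ofReal (Real.exp 1) * constCZ (covFun y P) N coef ρ) ^ (2 / ρ) *
                ENNReal.ofReal (max (b - a) (d - c)) ^ 2 *
                (ENNReal.ofReal θ * supStandard (powerOrlicz 2) (Icc a b ×ˢ Icc c d) U P)
                  ^ (-(2 / ρ)))) := by
  have hqV := (variationNorm_lt_top (g := fun l => |l| ^ q) hint).ne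
  have hnets := hasPolynomialNets_Icc_prod_Icc hab hcd le_rfl
  have hL : 0 < max (b - a) (d - c) + 1 :=
    add_pos_of_nonneg_of_pos ((sub_nonneg.2 hab).trans (le_max_left _ _)) one_pos
  have hnets' := hasPolynomialNets_Icc_prod_Icc hab hcd (lt_add_one _).le
  refine ⟨fun α hα Cy hs => ?_, fun hy hy0 => ?_⟩
  · have hφ := isPreOrlicz_powerOrlicz (one_pos.trans hα)
    refine ⟨exists_continuous_solutionField hκ hs hφ hvar hρ0 hρ1 hq hqV hL hnets',
      fun U hU h hh t ht t₁ ht₁ x hx x₁ hx₁ htt₁ hxx₁ =>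
        hU.subGaussianStandard_sub_le hκ hs hφ hvar hρ0 hρ1 (p := (t, x)) (p' := (t₁, x₁))
          ⟨ht, hx⟩ ⟨ht₁, hx₁⟩ hh (max_le htt₁ hxx₁),
      ?_, fun U hU hcont => ⟨hU.supStandard_lt_top hκ hs hφ hvar,
        fun θ hθ0 hθ1 hθ γ hαγ u hu => ?_⟩⟩
    · obtain ⟨K, hK⟩ := exists_subGaussianStandard_sub_le hκ hs hφ hvar hρ0 hρ1 hq hqV
      exact ⟨K, fun U hU h hh t ht t₁ ht₁ x hx x₁ hx₁ htt₁ hxx₁ =>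
        hK U hU (t, x) ⟨ht, hx⟩ (t₁, x₁) ⟨ht₁, hx₁⟩ h hh (max_le htt₁ hxx₁)⟩
    · have hαγ' : α.HolderConjugate γ :=
        Real.holderConjugate_iff.2 ⟨hα, by simpa only [one_div] using hαγ⟩
      exact_mod_cast hU.measure_lt_iSup_le hcont hκ hαγ' hs hvar hρ0 hρ1 two_ne_zero hnets hθ0
        hθ1 hθ hu
  · have hs := isStrictlyPhiSubGaussian_of_isGaussianProcess hy hy0
    have hφ := isPreOrlicz_powerOrlicz two_pos
    refine ⟨exists_continuous_solutionField hκ hs hφ hvar hρ0 hρ1 hq hqV hL hnets',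
      fun U hU hcont => ⟨hU.supStandard_lt_top hκ hs hφ hvar, fun θ hθ0 hθ1 hθ u hu => ?_⟩⟩
    simpa only [ENNReal.coe_one, mul_one, Real.rpow_two, Nat.cast_ofNat] using
      hU.measure_lt_iSup_le hcont hκ .two_two hs hvar hρ0 hρ1 two_ne_zero hnets hθ0 hθ1
        (by simpa only [ENNReal.coe_one, mul_one] using hθ) hu

theorem mainTheorem2 {Ω : Type*} [MeasurableSpace Ω] (P : Measure Ω) [IsProbabilityMeasure P]
    (N : ℕ) (hN : 1 ≤ N) (coef : ℕ → ℝ)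
    (κ : ℝ → ℝ) (hκ : κ = Real.cos ∨ κ = Real.sin)
    (a b c d : ℝ) (hab : a ≤ b) (hcd : c ≤ d)
    (ρ : ℝ) (hρ0 : 0 < ρ) (hρ1 : ρ ≤ 1)
    (y : ℝ → Ω → ℝ)
    (hvar : HasFiniteVitaliVariation (covFun y P))
    (hint : variationIntegral (covFun y P) (fun l m =>
        ENNReal.ofReal (|l| ^ ((2 * (N : ℝ) + 1) * (ρ + 1)) *
          |m| ^ ((2 * (N : ℝ) + 1) * (ρ + 1)))) < ∞) :
    -- the case of a strictly `φ`-sub-Gaussian process `y`, `φ(x) = |x| ^ α / α`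
    (∀ α : ℝ, 1 < α → α ≤ 2 → ∀ Cy : ℝ≥0, IsStrictlyPhiSubGaussian (powerOrlicz α) y Cy P →
      -- (i) existence, continuity, Hölder continuity
      (∃ U : ℝ × ℝ → Ω → ℝ,
        IsSolutionField κ N coef y (Icc a b ×ˢ Icc c d) U P ∧
        HasContinuousPathsOn (Icc a b ×ˢ Icc c d) U P) ∧
      (∀ U : ℝ × ℝ → Ω → ℝ,
        IsSolutionField κ N coef y (Icc a b ×ˢ Icc c d) U P →
        ∀ h : ℝ, 0 < h → ∀ t ∈ Icc a b, ∀ t₁ ∈ Icc a b, ∀ x ∈ Icc c d, ∀ x₁ ∈ Icc c d,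
          |t - t₁| ≤ h → |x - x₁| ≤ h →
          subGaussianStandard (powerOrlicz α) (fun ω => U (t, x) ω - U (t₁, x₁) ω) P
            ≤ 2 * constCZ (covFun y P) N coef ρ * Cy * ENNReal.ofReal (h ^ ρ)) ∧
      -- (the Hölder constant can be taken finite even if `C_Z = ∞`)
      (∃ K : ℝ≥0, ∀ U : ℝ × ℝ → Ω → ℝ,
        IsSolutionField κ N coef y (Icc a b ×ˢ Icc c d) U P →
        ∀ h : ℝ, 0 < h → ∀ t ∈ Icc a b, ∀ t₁ ∈ Icc a b, ∀ x ∈ Icc c d, ∀ x₁ ∈ Icc c d,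
          |t - t₁| ≤ h → |x - x₁| ≤ h →
          subGaussianStandard (powerOrlicz α) (fun ω => U (t, x) ω - U (t₁, x₁) ω) P
            ≤ (K : ℝ≥0∞) * ENNReal.ofReal (h ^ ρ)) ∧
      -- (ii) the distribution of the supremum
      (∀ U : ℝ × ℝ → Ω → ℝ,
        IsSolutionField κ N coef y (Icc a b ×ˢ Icc c d) U P →
        HasContinuousPathsOn (Icc a b ×ˢ Icc c d) U P →
        supStandard (powerOrlicz α) (Icc a b ×ˢ Icc c d) U P < ∞ ∧
        ∀ θ : ℝ, 0 < θ → θ < 1 →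
          ENNReal.ofReal θ * supStandard (powerOrlicz α) (Icc a b ×ˢ Icc c d) U P
            < 2 * constCZ (covFun y P) N coef ρ * Cy *
              ENNReal.ofReal (max (b - a) (d - c) / 2) ^ ρ →
          ∀ γ : ℝ, 1 / α + 1 / γ = 1 → ∀ u : ℝ, 0 < u →
            P {ω | ENNReal.ofReal u <
                ⨆ p ∈ Icc a b ×ˢ Icc c d, ENNReal.ofReal |U p ω|}
              ≤ 2 * ENNReal.ofReal (Real.exp (-(u ^ γ * (1 - θ) ^ γ /
                  (γ * (supStandard (powerOrlicz α) (Icc a b ×ˢ Icc c d) U P).toReal ^ γ)))) *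
                (2 * ENNReal.ofReal (Real.exp 1) * constCZ (covFun y P) N coef ρ * Cy)
                  ^ (2 / ρ) *
                ENNReal.ofReal (max (b - a) (d - c)) ^ 2 *
                (ENNReal.ofReal θ * supStandard (powerOrlicz α) (Icc a b ×ˢ Icc c d) U P)
                  ^ (-(2 / ρ)))) ∧
    -- the case of a centered Gaussian process `y`
    (IsGaussianProcess y P → (∀ s, ∫ ω, y s ω ∂P = 0) →
      (∃ U : ℝ × ℝ → Ω → ℝ,
        IsSolutionField κ N coef y (Icc a b ×ˢ Icc c d) U P ∧
        HasContinuousPathsOn (Icc a b ×ˢ Icc c d) U P) ∧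
      (∀ U : ℝ × ℝ → Ω → ℝ,
        IsSolutionField κ N coef y (Icc a b ×ˢ Icc c d) U P →
        HasContinuousPathsOn (Icc a b ×ˢ Icc c d) U P →
        supStandard (powerOrlicz 2) (Icc a b ×ˢ Icc c d) U P < ∞ ∧
        ∀ θ : ℝ, 0 < θ → θ < 1 →
          ENNReal.ofReal θ * supStandard (powerOrlicz 2) (Icc a b ×ˢ Icc c d) U P
            < 2 * constCZ (covFun y P) N coef ρ *
              ENNReal.ofReal (max (b - a) (d - c) / 2) ^ ρ →
          ∀ u : ℝ, 0 < u →
            P {ω | ENNReal.ofReal u <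
                ⨆ p ∈ Icc a b ×ˢ Icc c d, ENNReal.ofReal |U p ω|}
              ≤ 2 * ENNReal.ofReal (Real.exp (-(u ^ 2 * (1 - θ) ^ 2 /
                  (2 * (supStandard (powerOrlicz 2) (Icc a b ×ˢ Icc c d) U P).toReal ^ 2)))) *
                (2 * ENNReal.ofReal (Real.exp 1) * constCZ (covFun y P) N coef ρ) ^ (2 / ρ) *
                ENNReal.ofReal (max (b - a) (d - c)) ^ 2 *
                (ENNReal.ofReal θ * supStandard (powerOrlicz 2) (Icc a b ×ˢ Icc c d) U P)
                  ^ (-(2 / ρ)))) := by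
  have h := mainTheorem2_general P N coef κ (abs_sub_le_two_mul_abs_sin hκ) a b c d hab hcd ρ hρ0
    hρ1 _ (mul_le_mul_of_nonneg_left (lt_add_one ρ).le (by positivity)) y hvar hint
  exact ⟨fun α hα _ => h.1 α hα, h.2⟩
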